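/- Let $(Q_i)_{i\in I}$ be a family of polytopes, $Q_i\subseteq\mathbb{R}^{m}$ with $m=m(i)$, where each member is given to algorithms by some finite description of it. Suppose that the family is a tractable family of binary polytopes, that is: - every vertex of $Q_i$ is in $\{0,1\}^m$; - linear optimization over $Q_i$ can be done in polynomial time: there is an algorithm that, given (the description of) $Q_i$ and $c\in\mathbb{Q}^m$, returns a point of $Q_i$ minimizing $c^\top z$ over $z\in Q_i$ (or reports that $Q_i=\emptyset$), in time polynomial in $m$ and the bit length of $c$; - separation over $Q_i$ can be done in polynomial time: there is an algorithm that, given $Q_i$ and $y\in\mathbb{Q}^m$, either reports that $y\in Q_i$ or returns $c\in\mathbb{Q}^m$ with $c^\top y<c^\top z$ for all $z\in Q_i$, in time polynomial in $m$ and the bit length of $y$. For $Q=Q_i$ and $k\in\mathbb{Z}_{\ge 0}$ let $L_{k,Q}$ be the set of binary $k\times m$ matrices $[z_1,\ldots,z_k]^\top$ whose rows are in $Q$ (and hence are vertices of $Q$) and are in strictly increasing lexicographical order. Given $r\ge 1$, $n\ge 0$, matrices $A_1,\ldots,A_r\in\mathbb{Q}^{n\times m}$, vectors $\bar a_1,\ldots,\bar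 a_r\in\mathbb{Q}^n$ and numbers $b_1,\ldots,b_r\in\mathbb{Q}$, consider the inequalities in $x$ $$\sum_{i=1}^k \min_{1\le q\le r}\left\{x^\top A_q z_i+x^\top\bar a_q-b_q\right\}\ge 0\qquad\forall\,[z_1,\ldots,z_k]^\top\in L_{k,Q}.\qquad(*)$$ Then the inequalities $(*)$ can be separated in polynomial time: there is an algorithm that, given (the description of) $Q$, the numbers $m,n,r,k$, the data $A_q,\bar a_q,b_q$ ($1\le q\le r$) and a point $x\in\mathbb{Q}^n$, either reports that $x$ satisfies all of the inequalities $(*)$ or returns some $[z_1,\ldots,z_k]^\top\in L_{k,Q}$ whose inequality is violated by $x$, in time polynomial in $m+n+r+k$ and the bit length of $x$ and of the data $A_q,\bar a_q,b_q$. Here an algorithm is a program built by composition, pairing, branching and while-loops from elementary operations on finite binary trees with rational leaves (tree access, rational arithmetic, comparison), and its running time is measured by the logarithmic cost criterion: each step costs one plus the bit length of the data it handles. -/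

import Mathlib

/-! ### A machine model with a step count

Data are binary trees with rational numbers at the leaves. Programs are built from elementary
operations on data by composition, pairing, branching and while-loops. Time is counted by the
logarithmic cost criterion: every elementary step costs one plus the bit length of all the data it
reads and writes, so every program runs in time polynomially related to that of the corresponding
multitape Turing machine. -/

/-- Binary trees with rational leaves. -/
inductive Data where
  | num (q : ℚ)
  | pair (a b : Data)

namespace Data

/-- Bit length of a datum; a rational is a reduced fraction written in binary. -/
def size : Data → ℕ
  | num q => 1 + Nat.size q.num.natAbs + Nat.size q.den
  | pair a b => 1 + a.size + b.size

/-- A list of data as a right-nested tree that ends in the leaf `0`. -/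
def ofList : List Data → Data
  | [] => num 0
  | d :: l => pair d (ofList l)

/-- `none` is the leaf `0`, and `some d` is a pair. -/
def ofOption : Option Data → Data
  | none => num 0
  | some d => pair (num 1) d

/-- A rational vector, written as the list of its entries. -/
def ofVec {n : ℕ} (v : Fin n → ℚ) : Data :=
  ofList (List.ofFn fun i => num (v i))

/-- A rational matrix, written as the list of its rows. -/
def ofMat {m n : ℕ} (M : Fin m → Fin n → ℚ) : Data :=
  ofList (List.ofFn fun i => ofVec (M i))

end Data

/-- Elementary operations. The binary ones act on a pair of leaves. -/
inductive Op where
  | id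
  | const (q : ℚ)
  | fst
  | snd
  | isPair
  | add
  | sub
  | mul
  | div
  | le
  | numerator
  | denominator

/-- The effect of an elementary operation; the result is the leaf `0` where the operation does not
apply to the shape of the datum. -/
def Op.eval : Op → Data → Data
  | .id, d => d
  | .const q, _ => .num q
  | .fst, .pair a _ => a
  | .snd, .pair _ b => b
  | .isPair, .pair _ _ => .num 1
  | .add, .pair (.num a) (.num b) => .num (a + b)
  | .sub, .pair (.num a) (.num b) => .num (a - b)
  | .mul, .pair (.num a) (.num b) => .num (a * b)
  | .div, .pair (.num a) (.num b) => .num (a / b)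
  | .le, .pair (.num a) (.num b) => .num (if a ≤ b then 1 else 0)
  | .numerator, .num a => .num a.num
  | .denominator, .num a => .num a.den
  | _, _ => .num 0

/-- Programs. In tests the leaf `0` counts as false and every other datum as true. -/
inductive Prog where
  | op (o : Op)
  | comp (g f : Prog)
  | pair (f g : Prog)
  | ite (c f g : Prog)
  | loop (c f : Prog)

/-- `P.Runs v w t`: on input `v` the program `P` halts with output `w` after time `t`. -/
inductive Prog.Runs : Prog → Data → Data → ℕ → Prop
  | op (o : Op) (v : Data) : Runs (.op o) v (o.eval v) (1 + v.size + (o.eval v).size)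
  | comp {f g : Prog} {u v w : Data} {s t : ℕ} :
      Runs f u v s → Runs g v w t → Runs (.comp g f) u w (s + t + 1)
  | pair {f g : Prog} {u v w : Data} {s t : ℕ} :
      Runs f u v s → Runs g u w t →
      Runs (.pair f g) u (.pair v w) (s + t + 1 + u.size + (Data.pair v w).size)
  | ite_true {c f g : Prog} {u d w : Data} {s t : ℕ} :
      Runs c u d s → d ≠ .num 0 → Runs f u w t →
      Runs (.ite c f g) u w (s + t + 1 + u.size + d.size)
  | ite_false {c f g : Prog} {u w : Data} {s t : ℕ} :
      Runs c u (.num 0) s → Runs g u w t →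
      Runs (.ite c f g) u w (s + t + 1 + u.size + (Data.num 0).size)
  | loop_stop {c f : Prog} {u : Data} {s : ℕ} :
      Runs c u (.num 0) s →
      Runs (.loop c f) u u (s + 1 + u.size + (Data.num 0).size)
  | loop_step {c f : Prog} {u d v w : Data} {s t t' : ℕ} :
      Runs c u d s → d ≠ .num 0 → Runs f u v t → Runs (.loop c f) v w t' →
      Runs (.loop c f) u w (s + t + t' + 1 + u.size + d.size)

/-- A search problem: each instance is written as an input, has a size in terms of which running
times are measured, and has a set of valid outputs. -/
structure SearchProblem (I : Type*) where
  input : I → Data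
  size : I → ℕ
  Valid : I → Data → Prop

/-- Some program halts on every instance with a valid output, in time bounded by a polynomial in
the size of the instance. -/
def SearchProblem.PolyTimeSolvable {I : Type*} (S : SearchProblem I) : Prop :=
  ∃ (P : Prog) (p : Polynomial ℕ), ∀ i : I, ∃ (w : Data) (t : ℕ),
    P.Runs (S.input i) w t ∧ S.Valid i w ∧ t ≤ p.eval (S.size i)

/-! ### Tractable binary polytopes -/

/-- A rational vector as a real vector. -/
def realVec {m : ℕ} (v : Fin m → ℚ) : Fin m → ℝ := fun j => (v j : ℝ)

/-- A family of sets `Q i ⊆ ℝ^(dim i)`, where `code i` is the description of `Q i` that is given to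
algorithms (for instance, the graph of which `Q i` is the spanning tree polytope). -/
structure PolytopeFamily (ι : Type*) where
  dim : ι → ℕ
  Q : (i : ι) → Set (Fin (dim i) → ℝ)
  code : ι → Data

namespace PolytopeFamily

variable {ι : Type*}

/-- Linear optimization: given `i` and `c ∈ ℚ^m`, return a point of `Q i` that minimizes `c`
over `Q i`, or `none` if `Q i` is empty. The size is `m` plus the bit length of `c`. -/
def optimization (F : PolytopeFamily ι) :
    SearchProblem ((i : ι) × (Fin (F.dim i) → ℚ)) where
  input I := .pair (F.code I.1) (Data.ofVec I.2)
  size I := F.dim I.1 + (Data.ofVec I.2).size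
  Valid I w :=
    (F.Q I.1 = ∅ ∧ w = Data.ofOption none) ∨
    ∃ z : Fin (F.dim I.1) → ℚ, w = Data.ofOption (some (Data.ofVec z)) ∧
      realVec z ∈ F.Q I.1 ∧
      ∀ y ∈ F.Q I.1, realVec I.2 ⬝ᵥ realVec z ≤ realVec I.2 ⬝ᵥ y

/-- Separation: given `i` and `y ∈ ℚ^m`, return `none` if `y ∈ Q i`, and otherwise a vector `c`
such that `c ⬝ y < c ⬝ z` for all `z ∈ Q i`. The size is `m` plus the bit length of `y`. -/
def separation (F : PolytopeFamily ι) :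
    SearchProblem ((i : ι) × (Fin (F.dim i) → ℚ)) where
  input I := .pair (F.code I.1) (Data.ofVec I.2)
  size I := F.dim I.1 + (Data.ofVec I.2).size
  Valid I w :=
    (realVec I.2 ∈ F.Q I.1 ∧ w = Data.ofOption none) ∨
    ∃ c : Fin (F.dim I.1) → ℚ, w = Data.ofOption (some (Data.ofVec c)) ∧
      ∀ z ∈ F.Q I.1, realVec c ⬝ᵥ realVec I.2 < realVec c ⬝ᵥ z

/-- The members of the family are polytopes all of whose vertices are 0/1 vectors, and both
separation and linear optimization over them can be done in polynomial time. -/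
structure IsTractableBinary (F : PolytopeFamily ι) : Prop where
  polytope : ∀ i, ∃ V : Set (Fin (F.dim i) → ℝ), V.Finite ∧ F.Q i = convexHull ℝ V
  binary : ∀ i, ∀ z ∈ (F.Q i).extremePoints ℝ, ∀ j, z j = 0 ∨ z j = 1
  separation : F.separation.PolyTimeSolvable
  optimization : F.optimization.PolyTimeSolvable

end PolytopeFamily

/-! ### The joint-constraint inequalities -/

/-- `L_{k,Q}`: the `k × m` binary matrices whose rows are in (strictly) increasing lexicographical
order and lie in `Q`. -/
def lexTuples {m : ℕ} (k : ℕ) (Q : Set (Fin m → ℝ)) : Set (Fin k → Fin m → ℚ) :=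
  {z | (∀ i j, z i j = 0 ∨ z i j = 1) ∧ StrictMono (fun i => toLex (z i)) ∧
    ∀ i, realVec (z i) ∈ Q}

/-- A member `Q` of the family, the data `A_q`, `abar_q`, `b_q` (`1 ≤ q ≤ r`) and `k` of the
joint-constraint inequalities over `Q`, and a point `x` that is to be separated. -/
structure JointInstance {ι : Type*} (F : PolytopeFamily ι) where
  idx : ι
  n : ℕ
  r : ℕ
  k : ℕ
  r_pos : 0 < r
  x : Fin n → ℚ
  A : Fin r → Matrix (Fin n) (Fin (F.dim idx)) ℚ
  abar : Fin r → Fin n → ℚ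
  b : Fin r → ℚ

namespace JointInstance

variable {ι : Type*} {F : PolytopeFamily ι}

/-- `φ(x, z) = min_q {x^T A_q z + x^T abar_q - b_q}`. -/
def phi (J : JointInstance F) (z : Fin (F.dim J.idx) → ℚ) : ℚ :=
  Finset.univ.inf' ⟨⟨0, J.r_pos⟩, Finset.mem_univ _⟩ fun q : Fin J.r =>
    J.x ⬝ᵥ (J.A q).mulVec z + J.x ⬝ᵥ J.abar q - J.b q

/-- The inequality of the tuple `z` holds at `x`. -/
def Satisfied (J : JointInstance F) (z : Fin J.k → Fin (F.dim J.idx) → ℚ) : Prop :=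
  0 ≤ ∑ i, J.phi (z i)

/-- The numerical data of the instance. -/
def encodedData (J : JointInstance F) : Data :=
  Data.ofList
    [.num (F.dim J.idx), .num J.n, .num J.r, .num J.k, Data.ofVec J.x,
      Data.ofList (List.ofFn fun q => Data.ofMat (J.A q)), Data.ofMat J.abar, Data.ofVec J.b]

end JointInstance

/-- Separation of the joint-constraint inequalities: return `none` if `x` satisfies the
inequalities of all tuples in `L_{k,Q}`, and otherwise a tuple in `L_{k,Q}` whose inequality `x`
violates. The size is `m + n + r + k` plus the bit length of the numerical data. -/
def PolytopeFamily.jointSeparation {ι : Type*} (F : PolytopeFamily ι) :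
    SearchProblem (JointInstance F) where
  input J := .pair (F.code J.idx) J.encodedData
  size J := F.dim J.idx + J.n + J.r + J.k + J.encodedData.size
  Valid J w :=
    ((∀ z ∈ lexTuples J.k (F.Q J.idx), J.Satisfied z) ∧ w = Data.ofOption none) ∨
    ∃ z ∈ lexTuples J.k (F.Q J.idx), w = Data.ofOption (some (Data.ofMat z)) ∧ ¬ J.Satisfied z

/-!
Write `c_q = A_qᵀ x` and `d_q = xᵀ abar_q - b_q`, so that `φ(x, z) = min_q (c_q ⬝ z + d_q)`. The
sum of `φ(x, ·)` over a tuple in `L_{k,Q}` is least for the `k` binary points of `Q` with the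
smallest values of `φ(x, ·)`, and it does not depend on the order of the rows. So it suffices to
find these points.

They are found by a beam search in the tree of 0/1 strings of length at most `m`. The value of a
node `p` is `min_q min_{z ∈ Q} (c_q ⬝ z + d_q + M * dist(p, z))`, where `dist(p, z)` is the number
of entries in which `z` disagrees with the string `p`. On binary points this distance is an affine
function of `z`, so the value takes `r` calls of the optimization algorithm; any optimal point
will do, since the optimum is also attained at a vertex (`exists_binary_isMinOn`). The value of a
node is the smaller one of the values of its two children. Hence, if each level keeps the `k` best
children of the nodes kept on the level above, then the last level keeps `k` best strings of
length `m` (`beam_optimal`). The penalty `M` exceeds all differences of values of the affine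
functions, so the value of a string of length `m` tells whether it belongs to `Q`, and in this
case it is `φ(x, ·)` (`mem_of_nodeVal_le`, `nodeVal_eq_inf'`). Children replace their parent in
the list of kept nodes in lexicographic order, so the list found is in increasing lexicographic
order.

For the running time, `PolyTime sz e f` says that a program computes `f i` from the environment
`e i` in time polynomial in `sz i`. It is closed under the elementary operations, branching, and
polynomially long loops whose states have polynomially bounded length. Lengths stay bounded
because the magnitude `|numerator| + denominator` is submultiplicative for sums and products
(`Rat.mag_add_le`). The length of the code of `Q` does not count towards the size of an instance,
but as a program cannot run in less time than the length of its input, it is bounded by a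
polynomial in `m` (`PolytopeFamily.IsTractableBinary.exists_optimizer`).
-/

/-! ### Polynomially bounded functions -/

/-- `f` is bounded by a polynomial in the size function `sz`. -/
def PolyBdd {I : Type*} (sz f : I → ℕ) : Prop :=
  ∃ p : Polynomial ℕ, ∀ i, f i ≤ p.eval (sz i)

theorem Polynomial.monotone_eval_nat (p : Polynomial ℕ) : Monotone fun n => p.eval n := by
  intro a b hab
  induction p using Polynomial.induction_on' with
  | add p q hp hq => simpa using Nat.add_le_add hp hq
  | monomial n c => simpa using Nat.mul_le_mul_left c (Nat.pow_le_pow_left hab n)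

namespace PolyBdd

variable {I I' : Type*} {sz f g : I → ℕ}

theorem self : PolyBdd sz sz := ⟨.X, fun i => by simp⟩

theorem const (c : ℕ) : PolyBdd sz fun _ => c := ⟨.C c, fun i => by simp⟩

theorem mono (hg : PolyBdd sz g) (h : ∀ i, f i ≤ g i) : PolyBdd sz f :=
  let ⟨p, hp⟩ := hg
  ⟨p, fun i => (h i).trans (hp i)⟩

theorem add (hf : PolyBdd sz f) (hg : PolyBdd sz g) : PolyBdd sz fun i => f i + g i :=
  let ⟨p, hp⟩ := hf
  let ⟨q, hq⟩ := hg
  ⟨p + q, fun i => by simpa using Nat.add_le_add (hp i) (hq i)⟩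

theorem mul (hf : PolyBdd sz f) (hg : PolyBdd sz g) : PolyBdd sz fun i => f i * g i :=
  let ⟨p, hp⟩ := hf
  let ⟨q, hq⟩ := hg
  ⟨p * q, fun i => by simpa using Nat.mul_le_mul (hp i) (hq i)⟩

theorem eval (q : Polynomial ℕ) (hf : PolyBdd sz f) : PolyBdd sz fun i => q.eval (f i) :=
  let ⟨p, hp⟩ := hf
  ⟨q.comp p, fun i => by simpa using q.monotone_eval_nat (hp i)⟩

theorem reindex (π : I' → I) (hf : PolyBdd sz f) :
    PolyBdd (fun x => sz (π x)) fun x => f (π x) :=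
  let ⟨p, hp⟩ := hf
  ⟨p, fun x => hp (π x)⟩

end PolyBdd

/-! ### Bit lengths of rational numbers -/

/-- The magnitude `|numerator| + denominator` of a rational number. It is submultiplicative with
respect to sums as well as products, so that bit lengths of long sums add up instead of doubling
with every summand. -/
def Rat.mag (q : ℚ) : ℕ := q.num.natAbs + q.den

theorem Rat.mag_divInt_le (a : ℤ) {b : ℤ} (hb : b ≠ 0) :
    (Rat.divInt a b).mag ≤ a.natAbs + b.natAbs := by
  refine Nat.add_le_add ?_ ?_
  · rcases eq_or_ne a 0 with rfl | ha
    · simp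
    · exact Int.natAbs_le_of_dvd_ne_zero (Rat.num_dvd a hb) ha
  · simpa using Int.natAbs_le_of_dvd_ne_zero (Rat.den_dvd a b) hb

theorem Rat.mag_add_le (a b : ℚ) : (a + b).mag ≤ a.mag * b.mag := by
  have h : a + b = Rat.divInt (a.num * b.den + b.num * a.den) (a.den * b.den) := by
    conv_lhs => rw [← Rat.num_divInt_den a, ← Rat.num_divInt_den b]
    exact Rat.divInt_add_divInt _ _ (by simp) (by simp)
  rw [h]
  refine (Rat.mag_divInt_le _ (by simp)).trans ?_
  have := Int.natAbs_add_le (a.num * b.den) (b.num * a.den)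
  simp only [Int.natAbs_mul, Int.natAbs_natCast] at this ⊢
  unfold Rat.mag
  nlinarith [Nat.zero_le (a.num.natAbs * b.num.natAbs)]

theorem Rat.mag_neg (a : ℚ) : (-a).mag = a.mag := by simp [Rat.mag]

theorem Rat.mag_sub_le (a b : ℚ) : (a - b).mag ≤ a.mag * b.mag := by
  simpa [sub_eq_add_neg, Rat.mag_neg] using Rat.mag_add_le a (-b)

theorem Rat.mag_mul_le (a b : ℚ) : (a * b).mag ≤ a.mag * b.mag := by
  have h : a * b = Rat.divInt (a.num * b.num) (a.den * b.den) := by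
    conv_lhs => rw [← Rat.num_divInt_den a, ← Rat.num_divInt_den b]
    exact Rat.divInt_mul_divInt _ _
  rw [h]
  refine (Rat.mag_divInt_le _ (by simp)).trans ?_
  simp only [Int.natAbs_mul, Int.natAbs_natCast]
  unfold Rat.mag
  nlinarith [Nat.zero_le (a.num.natAbs * b.den), Nat.zero_le (b.num.natAbs * a.den)]

theorem Rat.mag_lt (q : ℚ) : q.mag < 2 ^ (Data.num q).size := by
  have h1 := Nat.lt_size_self q.num.natAbs
  have h2 := Nat.lt_size_self q.den
  have h3 : (Data.num q).size = q.num.natAbs.size + q.den.size + 1 := by simp [Data.size]; ring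
  have h4 := Nat.one_le_two_pow (n := q.num.natAbs.size)
  have h5 := Nat.one_le_two_pow (n := q.den.size)
  rw [h3, pow_succ, pow_add]
  unfold Rat.mag
  nlinarith

theorem Data.size_num_le_of_mag_lt {q : ℚ} {n : ℕ} (h : q.mag < 2 ^ n) :
    (Data.num q).size ≤ 1 + 2 * n := by
  have h1 : q.num.natAbs.size ≤ n := Nat.size_le.2 (lt_of_le_of_lt (Nat.le_add_right _ _) h)
  have h2 : q.den.size ≤ n := Nat.size_le.2 (lt_of_le_of_lt (Nat.le_add_left _ _) h)
  simp only [Data.size]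
  omega

theorem Data.size_num_of_mag_le_mul {a b c : ℚ} (h : c.mag ≤ a.mag * b.mag) :
    (Data.num c).size ≤ 1 + 2 * ((Data.num a).size + (Data.num b).size) := by
  refine Data.size_num_le_of_mag_lt (h.trans_lt ?_)
  rw [pow_add]
  exact Nat.mul_lt_mul_of_lt_of_le a.mag_lt b.mag_lt.le (by positivity)

theorem Data.size_zero : (Data.num 0).size = 2 := by simp [Data.size]

theorem Data.size_one : (Data.num 1).size = 3 := by simp [Data.size]

theorem Data.size_ofList (l : List Data) :
    (Data.ofList l).size = 2 + (l.map fun d => 1 + d.size).sum := by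
  induction l with
  | nil => simp [Data.ofList, Data.size_zero]
  | cons d l ih => simp [Data.ofList, Data.size, ih]; ring

/-- The bit length of a sum is linear in the total bit length of the summands. -/
theorem Rat.mag_sum_lt (l : List ℚ) : l.sum.mag < 2 ^ (Data.ofList (l.map .num)).size := by
  induction l with
  | nil => simp [Rat.mag, Data.ofList, Data.size_zero]
  | cons q l ih =>
    have : (Data.ofList ((q :: l).map .num)).size =
      (Data.num q).size + (Data.ofList (l.map .num)).size + 1 := by
      simp [Data.ofList, Data.size]; ring
    rw [this, pow_succ, pow_add, List.sum_cons]
    have h := Rat.mag_add_le q l.sum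
    have h1 := Nat.mul_lt_mul_of_lt_of_le q.mag_lt ih.le (by positivity)
    have : 0 < 2 ^ (Data.num q).size * 2 ^ (Data.ofList (l.map .num)).size := by positivity
    omega

theorem Data.size_num_sum_le (l : List ℚ) :
    (Data.num l.sum).size ≤ 1 + 2 * (Data.ofList (l.map .num)).size :=
  Data.size_num_le_of_mag_lt (Rat.mag_sum_lt l)

/-! ### Running times -/

/-- A program does not halt before it has read its input and written its output. So bounds on
running times are bounds on the lengths of inputs and outputs as well. -/
theorem Prog.Runs.size_le {P : Prog} {u w : Data} {t : ℕ} (h : P.Runs u w t) :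
    u.size ≤ t ∧ w.size ≤ t := by
  induction h <;> constructor <;> omega

/-- A loop that runs through the states `s 0, …, s n`. -/
theorem Prog.Runs.loop_of_states {c f : Prog} {X : ℕ} (n : ℕ) {s d : ℕ → Data}
    (hc : ∀ j < n, ∃ t ≤ X, c.Runs (s j) (d j) t) (hd : ∀ j < n, d j ≠ .num 0)
    (hend : ∃ t ≤ X, c.Runs (s n) (.num 0) t)
    (hf : ∀ j < n, ∃ t ≤ X, f.Runs (s j) (s (j + 1)) t) :
    ∃ t ≤ (n + 1) * (4 * X + 1), (Prog.loop c f).Runs (s 0) (s n) t := by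
  induction n generalizing s d with
  | zero =>
    obtain ⟨t, ht, h⟩ := hend
    refine ⟨_, ?_, Prog.Runs.loop_stop h⟩
    have := h.size_le
    omega
  | succ n ih =>
    obtain ⟨t₁, ht₁, h₁⟩ := hc 0 n.succ_pos
    obtain ⟨t₂, ht₂, h₂⟩ := hf 0 n.succ_pos
    obtain ⟨t₃, ht₃, h₃⟩ := ih (s := fun j => s (j + 1)) (d := fun j => d (j + 1))
      (fun j hj => hc (j + 1) (by omega)) (fun j hj => hd (j + 1) (by omega)) hend
      (fun j hj => hf (j + 1) (by omega))
    refine ⟨_, ?_, .loop_step h₁ (hd 0 n.succ_pos) h₂ h₃⟩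
    have := h₁.size_le
    rw [add_mul (n + 1) 1]
    omega

/-! ### Functions computable in polynomial time -/

/-- Types whose elements are written as data: numbers as leaves, truth values as the leaves `0` and
`1`, pairs as pairs, and lists as right-nested trees that end in the leaf `0`. -/
class DataEnc (α : Type*) where
  enc : α → Data

open DataEnc (enc)

instance : DataEnc Data := ⟨id⟩
instance : DataEnc ℚ := ⟨.num⟩
instance : DataEnc Bool := ⟨fun b => .num (if b then 1 else 0)⟩
instance {α β : Type*} [DataEnc α] [DataEnc β] : DataEnc (α × β) :=
  ⟨fun x => .pair (enc x.1) (enc x.2)⟩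
instance {α : Type*} [DataEnc α] : DataEnc (List α) := ⟨fun l => .ofList (l.map enc)⟩

/-- Some program computes `f i` from `e i`, for all `i`, in time polynomial in `sz i`. Here `e i` is
the environment: the data that are available to the program. The rules below build such programs
in the manner of a functional language; the body of a loop is a program whose environment is
that of the loop, paired with the data of the current round, and which is indexed by the pairs
of an index of the loop and a round. -/
def PolyTime {I α : Type*} [DataEnc α] (sz : I → ℕ) (e : I → Data) (f : I → α) : Prop :=
  ∃ (P : Prog) (t : I → ℕ), (∀ i, P.Runs (e i) (enc (f i)) (t i)) ∧ PolyBdd sz t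

namespace PolyTime

universe u
variable {I : Type u} {I' α β γ : Type*} [DataEnc α] [DataEnc β] [DataEnc γ]
  {sz : I → ℕ} {e : I → Data} {f : I → α} {g : I → β}

theorem bdd_env (h : PolyTime sz e f) : PolyBdd sz fun i => (e i).size :=
  let ⟨_, _, hr, ht⟩ := h
  ht.mono fun i => (hr i).size_le.1

theorem bdd (h : PolyTime sz e f) : PolyBdd sz fun i => (enc (f i)).size :=
  let ⟨_, _, hr, ht⟩ := h
  ht.mono fun i => (hr i).size_le.2

theorem of_enc_eq (h : PolyTime sz e f) (hfg : ∀ i, enc (f i) = enc (g i)) : PolyTime sz e g :=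
  let ⟨P, t, hr, ht⟩ := h
  ⟨P, t, fun i => hfg i ▸ hr i, ht⟩

theorem congr {f' : I → α} (h : PolyTime sz e f) (hf : ∀ i, f i = f' i) : PolyTime sz e f' :=
  h.of_enc_eq fun i => by rw [hf]

theorem reindex (h : PolyTime sz e f) (π : I' → I) :
    PolyTime (fun x => sz (π x)) (fun x => e (π x)) fun x => f (π x) :=
  let ⟨P, t, hr, ht⟩ := h
  ⟨P, fun x => t (π x), fun x => hr (π x), ht.reindex π⟩

/-- Composition: the output of the first program is the environment of the second one. -/
theorem comp (hf : PolyTime sz e f) (hg : PolyTime sz (fun i => enc (f i)) g) :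
    PolyTime sz e g :=
  let ⟨P, s, hP, hs⟩ := hf
  let ⟨R, t, hR, ht⟩ := hg
  ⟨.comp R P, fun i => s i + t i + 1, fun i => .comp (hP i) (hR i), (hs.add ht).add (.const 1)⟩

theorem op_env {o : Op} {C : ℕ} (ho : ∀ d, (o.eval d).size ≤ C + 4 * d.size)
    (he : PolyBdd sz fun i => (e i).size) : PolyTime sz e fun i => o.eval (e i) :=
  ⟨.op o, _, fun i => .op o (e i), (((PolyBdd.const 1).add he).add
    (((PolyBdd.const C).add ((PolyBdd.const 4).mul he)).mono fun i => ho (e i)))⟩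

theorem op (o : Op) {C : ℕ} (ho : ∀ d, (o.eval d).size ≤ C + 4 * d.size)
    (hf : PolyTime sz e f) : PolyTime sz e fun i => o.eval (enc (f i)) :=
  hf.comp (op_env ho hf.bdd)

/-- The environment is its own output. All other outputs are built from this one, so this is where a
bound on the length of the environment has to be supplied. -/
theorem env (he : PolyBdd sz fun i => (e i).size) : PolyTime sz e e :=
  op_env (o := .id) (C := 0) (fun d => by simp [Op.eval]; omega) he

theorem const (q : ℚ) (hf : PolyTime sz e f) : PolyTime sz e fun _ => q :=
  op (.const q) (C := (Data.num q).size) (fun d => by simp [Op.eval]) hf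

theorem pair (hf : PolyTime sz e f) (hg : PolyTime sz e g) : PolyTime sz e fun i => (f i, g i) :=
  have hb := hf.bdd_env
  have hf' := hf.bdd
  have hg' := hg.bdd
  let ⟨P, s, hP, hs⟩ := hf
  let ⟨R, t, hR, ht⟩ := hg
  ⟨.pair P R, _, fun i => .pair (hP i) (hR i),
    (((hs.add ht).add (.const 1)).add hb).add
      ((((PolyBdd.const 1).add hf').add hg').mono fun i => by simp [Data.size])⟩

theorem size_op_fst (d : Data) : (Op.fst.eval d).size ≤ 2 + 4 * d.size := by
  cases d <;> simp only [Op.eval, Data.size, Data.size_zero] <;> omega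

theorem size_op_snd (d : Data) : (Op.snd.eval d).size ≤ 2 + 4 * d.size := by
  cases d <;> simp only [Op.eval, Data.size, Data.size_zero] <;> omega

theorem size_op_isPair (d : Data) : (Op.isPair.eval d).size ≤ 3 + 4 * d.size := by
  cases d <;> simp only [Op.eval, Data.size, Data.size_zero, Data.size_one] <;> omega

theorem fst {f : I → α × β} (hf : PolyTime sz e f) : PolyTime sz e fun i => (f i).1 :=
  (op .fst size_op_fst hf).of_enc_eq fun _ => rfl

theorem snd {f : I → α × β} (hf : PolyTime sz e f) : PolyTime sz e fun i => (f i).2 :=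
  (op .snd size_op_snd hf).of_enc_eq fun _ => rfl

theorem isPair {f : I → Data} (hf : PolyTime sz e f) :
    PolyTime sz e fun i => (match f i with | .pair _ _ => true | .num _ => false : Bool) :=
  (op .isPair size_op_isPair hf).of_enc_eq fun i => by
    change Op.isPair.eval (f i) = enc (match f i with | .pair _ _ => true | .num _ => false : Bool)
    cases f i <;> rfl

theorem size_binary {o : Op} (h : ∀ d, (∃ a b, d = .pair (.num a) (.num b)) ∨ o.eval d = .num 0)
    (h' : ∀ a b, (o.eval (.pair (.num a) (.num b))).size ≤
      3 + 2 * ((Data.num a).size + (Data.num b).size)) (d : Data) :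
    (o.eval d).size ≤ 3 + 4 * d.size := by
  rcases h d with ⟨a, b, rfl⟩ | h
  · refine (h' a b).trans ?_
    simp only [Data.size]
    omega
  · rw [h, Data.size_zero]
    omega

theorem add {f g : I → ℚ} (hf : PolyTime sz e f) (hg : PolyTime sz e g) :
    PolyTime sz e fun i => f i + g i :=
  (op .add (size_binary (by rintro (_ | ⟨_ | _, _ | _⟩) <;> simp [Op.eval]) fun a b =>
    (Data.size_num_of_mag_le_mul (Rat.mag_add_le a b)).trans (by omega)) (hf.pair hg)).of_enc_eq
    fun _ => rfl

theorem sub {f g : I → ℚ} (hf : PolyTime sz e f) (hg : PolyTime sz e g) :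
    PolyTime sz e fun i => f i - g i :=
  (op .sub (size_binary (by rintro (_ | ⟨_ | _, _ | _⟩) <;> simp [Op.eval]) fun a b =>
    (Data.size_num_of_mag_le_mul (Rat.mag_sub_le a b)).trans (by omega)) (hf.pair hg)).of_enc_eq
    fun _ => rfl

theorem mul {f g : I → ℚ} (hf : PolyTime sz e f) (hg : PolyTime sz e g) :
    PolyTime sz e fun i => f i * g i :=
  (op .mul (size_binary (by rintro (_ | ⟨_ | _, _ | _⟩) <;> simp [Op.eval]) fun a b =>
    (Data.size_num_of_mag_le_mul (Rat.mag_mul_le a b)).trans (by omega)) (hf.pair hg)).of_enc_eq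
    fun _ => rfl

theorem le {f g : I → ℚ} (hf : PolyTime sz e f) (hg : PolyTime sz e g) :
    PolyTime sz e fun i => decide (f i ≤ g i) :=
  (op .le (size_binary (by rintro (_ | ⟨_ | _, _ | _⟩) <;> simp [Op.eval]) fun a b => by
      simp only [Op.eval]
      split <;> simp only [Data.size_zero, Data.size_one] <;> omega) (hf.pair hg)).of_enc_eq
    fun i => by simp [Op.eval, enc]

theorem cond {c : I → Bool} {f g : I → α} (hc : PolyTime sz e c) (hf : PolyTime sz e f)
    (hg : PolyTime sz e g) : PolyTime sz e fun i => bif c i then f i else g i := by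
  have hb := hf.bdd_env
  have hc' := hc.bdd
  obtain ⟨P, s, hP, hs⟩ := hc
  obtain ⟨R, t, hR, ht⟩ := hf
  obtain ⟨S, u, hS, hu⟩ := hg
  refine ⟨.ite P R S,
    fun i => s i + (bif c i then t i else u i) + 1 + (e i).size + (enc (c i)).size, fun i => ?_,
    ((((hs.add ((ht.add hu).mono fun i => ?_)).add (.const 1)).add hb).add hc')⟩
  · have := hP i
    cases hi : c i <;> rw [hi] at this <;> simp only [hi, cond_true, cond_false]
    · exact .ite_false this (hS i)
    · exact .ite_true this (by simp [enc]) (hR i)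
  · cases c i <;> simp

theorem and {b c : I → Bool} (hb : PolyTime sz e b) (hc : PolyTime sz e c) :
    PolyTime sz e fun i => b i && c i :=
  (hb.cond hc (f := c) ((hb.const 0).of_enc_eq (g := fun _ => false) fun _ => by simp [enc])).congr
    fun i => by cases b i <;> rfl

theorem not {b : I → Bool} (hb : PolyTime sz e b) : PolyTime sz e fun i => !b i :=
  (hb.cond (f := fun _ => false) (g := fun _ => true)
    ((hb.const 0).of_enc_eq fun _ => by simp [enc])
    ((hb.const 1).of_enc_eq fun _ => by simp [enc])).congr fun i => by cases b i <;> rfl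

theorem lt {f g : I → ℚ} (hf : PolyTime sz e f) (hg : PolyTime sz e g) :
    PolyTime sz e fun i => decide (f i < g i) :=
  (hg.le hf).not.congr fun i => by simp [← not_le]

theorem eq {f g : I → ℚ} (hf : PolyTime sz e f) (hg : PolyTime sz e g) :
    PolyTime sz e fun i => decide (f i = g i) :=
  ((hf.le hg).and (hg.le hf)).congr fun i => by simp [le_antisymm_iff]

theorem nil (hf : PolyTime sz e f) : PolyTime sz e fun _ => ([] : List β) :=
  (hf.const 0).of_enc_eq fun _ => rfl

theorem cons {l : I → List α} (hf : PolyTime sz e f) (hl : PolyTime sz e l) :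
    PolyTime sz e fun i => f i :: l i :=
  (hf.pair hl).of_enc_eq fun _ => rfl

/-- A variable of an outer environment. -/
theorem weaken {κ : I → Type*} {b : (Σ i, κ i) → Data} {h : (Σ i, κ i) → β}
    (hf : PolyTime sz e f)
    (hh : PolyTime (fun x : Σ i, κ i => sz x.1) (fun x => .pair (e x.1) (b x)) h) :
    PolyTime (fun x : Σ i, κ i => sz x.1) (fun x => .pair (e x.1) (b x)) fun x => f x.1 :=
  (op_env (o := .fst) size_op_fst hh.bdd_env).comp (hf.reindex Sigma.fst)

/-- A loop runs in polynomial time if the number of rounds is polynomially bounded and the test and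
the body do so uniformly in the rounds. The latter includes that the states have polynomially
bounded length. -/
theorem loop {s : I → ℕ → Data} {n : I → ℕ} (hn : PolyBdd sz n)
    (hc : PolyTime (fun x : Σ i, Fin (n i + 1) => sz x.1) (fun x => s x.1 x.2)
      fun x => decide (x.2.val < n x.1))
    (hf : PolyTime (fun x : Σ i, Fin (n i) => sz x.1) (fun x => s x.1 x.2)
      fun x => s x.1 (x.2 + 1)) :
    PolyTime sz (fun i => s i 0) fun i => s i (n i) := by
  obtain ⟨P, tP, hP, p, hp⟩ := hc
  obtain ⟨R, tR, hR, q, hq⟩ := hf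
  have key (i : I) := Prog.Runs.loop_of_states (c := P) (f := R)
    (X := p.eval (sz i) + q.eval (sz i)) (n i) (s := s i) (d := fun j => enc (decide (j < n i)))
    (fun j hj => ⟨_, (hp ⟨i, ⟨j, by omega⟩⟩).trans (by simp), hP ⟨i, ⟨j, by omega⟩⟩⟩)
    (fun j hj => by simp [enc, hj])
    ⟨_, (hp ⟨i, ⟨n i, by omega⟩⟩).trans (by simp), by
      simpa [enc] using hP ⟨i, ⟨n i, by omega⟩⟩⟩
    (fun j hj => ⟨_, (hq ⟨i, ⟨j, hj⟩⟩).trans (by simp), hR ⟨i, ⟨j, hj⟩⟩⟩)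
  choose t ht hr using key
  refine ⟨.loop P R, t, hr, PolyBdd.mono ?_ ht⟩
  exact (hn.add (.const 1)).mul (((PolyBdd.const 4).mul
    ((PolyBdd.self.eval p).add (PolyBdd.self.eval q))).add (.const 1))

end PolyTime

/-! ### Programs on lists -/

theorem DataEnc.size_list {α : Type*} [DataEnc α] (l : List α) :
    (enc l).size = 2 + (l.map fun a => 1 + (enc a).size).sum := by
  change (Data.ofList (l.map enc)).size = _
  rw [Data.size_ofList, List.map_map]
  rfl

theorem DataEnc.size_sublist {α : Type*} [DataEnc α] {l l' : List α} (h : l.Sublist l') :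
    (enc l).size ≤ (enc l').size := by
  simp only [DataEnc.size_list]
  exact Nat.add_le_add_left ((h.map _).sum_le_sum fun _ _ => Nat.zero_le _) 2

theorem DataEnc.size_reverse {α : Type*} [DataEnc α] (l : List α) :
    (enc l.reverse).size = (enc l).size := by
  simp only [DataEnc.size_list, List.map_reverse, List.sum_reverse]

theorem DataEnc.size_mem {α : Type*} [DataEnc α] {l : List α} {a : α} (h : a ∈ l) :
    (enc a).size ≤ (enc l).size := by
  rw [DataEnc.size_list]
  have := List.le_sum_of_mem (List.mem_map_of_mem (f := fun a => 1 + (enc a).size) h)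
  omega

theorem DataEnc.size_list_le {α : Type*} [DataEnc α] {l : List α} {B : ℕ}
    (h : ∀ a ∈ l, (enc a).size ≤ B) : (enc l).size ≤ 2 + l.length * (1 + B) := by
  rw [DataEnc.size_list]
  have := List.sum_le_card_nsmul (l.map fun a => 1 + (enc a).size) (1 + B) (by simpa using h)
  simpa using this

theorem DataEnc.length_le_size {α : Type*} [DataEnc α] (l : List α) :
    l.length ≤ (enc l).size := by
  rw [DataEnc.size_list]
  have := List.card_nsmul_le_sum (l.map fun a => 1 + (enc a).size) 1 (by simp)
  simp only [List.length_map, smul_eq_mul, mul_one] at this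
  omega

theorem DataEnc.size_append_le {α : Type*} [DataEnc α] (l l' : List α) :
    (enc (l ++ l')).size ≤ (enc l).size + (enc l').size := by
  simp only [DataEnc.size_list, List.map_append, List.sum_append]
  omega

theorem DataEnc.size_flatten_le {α : Type*} [DataEnc α] (l : List (List α)) :
    (enc l.flatten).size ≤ (enc l).size := by
  induction l with
  | nil => exact le_rfl
  | cons a l ih =>
    have := DataEnc.size_append_le a l.flatten
    have h : (enc (a :: l)).size = 1 + (enc a).size + (enc l).size := rfl
    simp only [List.flatten_cons]
    omega

theorem List.drop_ofFn_eq_cons {α : Type*} {n : ℕ} (a : Fin n → α) (j : Fin n) :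
    (List.ofFn a).drop j = a j :: (List.ofFn a).drop (j + 1) := by
  rw [List.drop_eq_getElem_cons (by simp)]
  simp

theorem List.take_ofFn_succ {α : Type*} {n : ℕ} (a : Fin n → α) (j : Fin n) :
    (List.ofFn a).take (j + 1) = (List.ofFn a).take j ++ [a j] := by
  rw [List.take_succ_eq_append_getElem (by simp)]
  simp

theorem List.take_ofFn_self {α : Type*} {n : ℕ} (a : Fin n → α) :
    (List.ofFn a).take n = List.ofFn a := List.take_of_length_le (by simp)

/-- The minimum of a nonempty list of numbers (and `0` for the empty list). -/
def List.minD (l : List ℚ) : ℚ := l.foldl min (l.headD 0)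

theorem List.foldl_min_mem (l : List ℚ) (d : ℚ) : l.foldl min d ∈ d :: l := by
  induction l generalizing d with
  | nil => simp
  | cons a l ih =>
    rcases List.mem_cons.1 (ih (min d a)) with h | h
    · rw [List.foldl_cons, h]
      rcases min_choice d a with h' | h' <;> simp [h']
    · exact List.mem_cons_of_mem _ (List.mem_cons_of_mem _ h)

theorem List.foldl_min_le (l : List ℚ) (d : ℚ) :
    l.foldl min d ≤ d ∧ ∀ a ∈ l, l.foldl min d ≤ a := by
  induction l generalizing d with
  | nil => simp
  | cons b l ih =>
    obtain ⟨h, h'⟩ := ih (min d b)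
    refine ⟨h.trans (min_le_left _ _), fun a ha => ?_⟩
    rcases List.mem_cons.1 ha with rfl | ha
    · exact h.trans (min_le_right _ _)
    · exact h' a ha

theorem List.minD_isLeast {l : List ℚ} (hl : l ≠ []) : IsLeast {a | a ∈ l} l.minD := by
  obtain ⟨a, l, rfl⟩ := List.exists_cons_of_ne_nil hl
  refine ⟨?_, fun b hb => (List.foldl_min_le _ _).2 b hb⟩
  have := List.foldl_min_mem (a :: l) a
  simpa [List.minD] using this

namespace PolyTime

universe u
variable {I : Type u} {I' α β γ : Type*} [DataEnc α] [DataEnc β] [DataEnc γ]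
  {sz : I → ℕ} {e : I → Data} {f : I → α} {g : I → β} {N : I → ℕ}

theorem uncons {l l' : I → List α} {a : I → α} (h : PolyTime sz e l)
    (hl : ∀ i, l i = a i :: l' i) : PolyTime sz e fun i => (a i, l' i) :=
  h.of_enc_eq fun i => by rw [hl]; rfl

theorem headD {l : I → List Data} (h : PolyTime sz e l) :
    PolyTime sz e fun i => (l i).headD (.num 0) :=
  (h.op .fst size_op_fst).of_enc_eq fun i => by cases l i <;> rfl

theorem tail {l : I → List α} (h : PolyTime sz e l) : PolyTime sz e fun i => (l i).tail :=
  (h.op .snd size_op_snd).of_enc_eq fun i => by cases l i <;> rfl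

theorem isCons {l : I → List α} (h : PolyTime sz e l) :
    PolyTime sz e fun i => decide (0 < (l i).length) :=
  (h.op .isPair size_op_isPair).of_enc_eq fun i => by cases l i <;> rfl

theorem bdd_length {l : I → List α} (h : PolyTime sz e l) : PolyBdd sz fun i => (l i).length :=
  h.bdd.mono fun i => DataEnc.length_le_size (l i)

/-- Folding over a list, where `acc i j` is the value after `j` entries have been handled. -/
theorem foldFn {a : ∀ i, Fin (N i) → α} {acc : I → ℕ → β}
    (ha : PolyTime sz e fun i => List.ofFn (a i)) (h0 : PolyTime sz e fun i => acc i 0)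
    (hacc : PolyBdd (fun x : Σ i, Fin (N i + 1) => sz x.1) fun x => (enc (acc x.1 x.2)).size)
    (hstep : PolyTime (fun x : Σ i, Fin (N i) => sz x.1)
        (fun x => .pair (e x.1) (enc (a x.1 x.2, acc x.1 x.2)))
        (fun x => (a x.1 x.2, acc x.1 x.2)) →
      PolyTime (fun x : Σ i, Fin (N i) => sz x.1)
        (fun x => .pair (e x.1) (enc (a x.1 x.2, acc x.1 x.2))) fun x => acc x.1 (x.2 + 1)) :
    PolyTime sz e fun i => acc i (N i) := by
  let s (i : I) (j : ℕ) : Data × List α × β := (e i, (List.ofFn (a i)).drop j, acc i j)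
  have hN : PolyBdd sz N := ha.bdd_length.mono fun i => by simp
  have hbdd : PolyBdd (fun x : Σ i, Fin (N i + 1) => sz x.1) fun x => (enc (s x.1 x.2)).size :=
    ((((PolyBdd.const 2).add (ha.bdd_env.reindex Sigma.fst)).add
      (ha.bdd.reindex Sigma.fst)).add hacc).mono fun x => by
        have := DataEnc.size_sublist (List.drop_sublist x.2 (List.ofFn (a x.1)))
        have h : (enc (s x.1 x.2)).size = 1 + (e x.1).size +
          (1 + (enc ((List.ofFn (a x.1)).drop x.2)).size + (enc (acc x.1 x.2)).size) := rfl
        omega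
  have hbdd' : PolyBdd (fun x : Σ i, Fin (N i) => sz x.1) fun x => (enc (s x.1 x.2)).size :=
    hbdd.reindex fun x : Σ i, Fin (N i) => (⟨x.1, x.2.castSucc⟩ : Σ i, Fin (N i + 1))
  have hs : PolyTime (fun x : Σ i, Fin (N i + 1) => sz x.1) (fun x => enc (s x.1 x.2))
    (fun x => s x.1 x.2) := env hbdd
  have hs' : PolyTime (fun x : Σ i, Fin (N i) => sz x.1) (fun x => enc (s x.1 x.2))
    (fun x => s x.1 x.2) := env hbdd'
  have hd := hs'.snd.fst.uncons fun x => List.drop_ofFn_eq_cons (a x.1) x.2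
  have hin : PolyTime (fun x : Σ i, Fin (N i) => sz x.1) (fun x => enc (s x.1 x.2))
    (fun x => (e x.1, a x.1 x.2, acc x.1 x.2)) := hs'.fst.pair (hd.fst.pair hs'.snd.snd)
  have hl := loop hN (s := fun i j => enc (s i j))
    (hs.snd.fst.isCons.congr fun x => by
      simp only [s, List.length_drop, List.length_ofFn]
      exact decide_eq_decide.2 (by omega))
    (hs'.fst.pair (hd.snd.pair (hin.comp (hstep (PolyTime.snd (env hin.bdd))))))
  have h0' : PolyTime sz e fun i => s i 0 := (env ha.bdd_env).pair (ha.pair h0)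
  have h1 : PolyTime sz e fun i => s i (N i) := h0'.comp hl
  exact h1.snd.snd

theorem reverseFn {a : ∀ i, Fin (N i) → α} (ha : PolyTime sz e fun i => List.ofFn (a i)) :
    PolyTime sz e fun i => (List.ofFn (a i)).reverse := by
  refine (foldFn (acc := fun i j => ((List.ofFn (a i)).take j).reverse) ha ha.nil
    ((ha.bdd.reindex Sigma.fst).mono fun x => ?_) fun hx => ?_).congr fun i => ?_
  · rw [DataEnc.size_reverse]
    exact DataEnc.size_sublist (List.take_sublist _ _)
  · exact (hx.fst.cons hx.snd).congr fun x => by simp [List.take_ofFn_succ]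
  · rw [List.take_ofFn_self]

theorem reverse {l : I → List α} (hl : PolyTime sz e l) : PolyTime sz e fun i => (l i).reverse :=
  (reverseFn (a := fun i => (l i).get) (hl.congr fun i => by simp)).congr fun i => by simp

/-- Applying a program to every entry of a list. The entry `b i j` may depend on the position `j`,
and not only on `a i j`, as long as it can be computed from `a i j` and the environment. -/
theorem mapFn {a : ∀ i, Fin (N i) → α} {b : ∀ i, Fin (N i) → β}
    (ha : PolyTime sz e fun i => List.ofFn (a i))
    (hb : PolyTime (fun x : Σ i, Fin (N i) => sz x.1) (fun x => .pair (e x.1) (enc (a x.1 x.2)))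
        (fun x => a x.1 x.2) →
      PolyTime (fun x : Σ i, Fin (N i) => sz x.1) (fun x => .pair (e x.1) (enc (a x.1 x.2)))
        fun x => b x.1 x.2) :
    PolyTime sz e fun i => List.ofFn (b i) := by
  have hbdd : PolyBdd (fun x : Σ i, Fin (N i) => sz x.1)
      fun x => (Data.pair (e x.1) (enc (a x.1 x.2))).size :=
    (((PolyBdd.const 1).add (ha.bdd_env.reindex Sigma.fst)).add (ha.bdd.reindex Sigma.fst)).mono
      fun x => Nat.add_le_add_left (DataEnc.size_mem (by simp [List.mem_ofFn])) _
  replace hb := hb ((env hbdd).op .snd size_op_snd)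
  have hN : PolyBdd sz N := ha.bdd_length.mono fun i => by simp
  obtain ⟨p, hp⟩ := hb.bdd
  have hout : PolyBdd sz fun i => (enc (List.ofFn (b i))).size :=
    ((PolyBdd.const 2).add (hN.mul ((PolyBdd.const 1).add (PolyBdd.self.eval p)))).mono
      fun i => (DataEnc.size_list_le (B := p.eval (sz i)) fun x hx => by
        obtain ⟨j, rfl⟩ := (List.mem_ofFn ..).1 hx
        exact hp ⟨i, j⟩).trans (by simp)
  refine ((foldFn (acc := fun i j => ((List.ofFn (b i)).take j).reverse) ha ha.nil
    ((hout.reindex Sigma.fst).mono fun x => ?_) fun hx => ?_).congr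
      (f' := fun i => (List.ofFn (b i)).reverse) fun i => ?_).reverse.congr fun i => ?_
  · rw [DataEnc.size_reverse]
    exact DataEnc.size_sublist (List.take_sublist _ _)
  · have h := (op_env (o := .fst) size_op_fst hx.bdd_env).pair hx.fst
    have h' := h.comp hb
    exact (h'.cons hx.snd).congr fun x => by simp [List.take_ofFn_succ]
  · rw [List.take_ofFn_self]
  · simp

theorem append {l l' : I → List α} (hl : PolyTime sz e l) (hl' : PolyTime sz e l') :
    PolyTime sz e fun i => l i ++ l' i := by
  have h : PolyTime sz e fun i => List.ofFn (l i).reverse.get :=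
    hl.reverse.congr fun i => (List.ofFn_get _).symm
  refine (foldFn (acc := fun i j => ((List.ofFn (l i).reverse.get).take j).reverse ++ l' i) h
    (hl'.congr fun i => by simp)
    (((hl.bdd.add hl'.bdd).reindex Sigma.fst).mono fun x => ?_) fun hx => ?_).congr fun i => ?_
  · refine (DataEnc.size_append_le _ _).trans (Nat.add_le_add_right ?_ _)
    rw [DataEnc.size_reverse]
    refine (DataEnc.size_sublist (List.take_sublist _ _)).trans ?_
    rw [List.ofFn_get, DataEnc.size_reverse]
  · exact (hx.fst.cons hx.snd).congr fun x => by simp only [List.take_ofFn_succ]; simp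
  · rw [List.take_ofFn_self, List.ofFn_get, List.reverse_reverse]

theorem flatten {l : I → List (List α)} (hl : PolyTime sz e l) :
    PolyTime sz e fun i => (l i).flatten := by
  have h : PolyTime sz e fun i => List.ofFn (l i).get := hl.congr fun i => by simp
  refine (foldFn (acc := fun i j => ((List.ofFn (l i).get).take j).flatten) h
    (hl.nil.congr fun i => by simp)
    ((hl.bdd.reindex Sigma.fst).mono fun x => ?_) fun hx => ?_).congr fun i => ?_
  · refine (DataEnc.size_flatten_le _).trans ?_
    refine (DataEnc.size_sublist (List.take_sublist _ _)).trans ?_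
    rw [List.ofFn_get]
  · exact (hx.snd.append hx.fst).congr fun x => by
      rw [List.take_ofFn_succ, List.flatten_append, List.flatten_singleton]
  · rw [List.take_ofFn_self]
    simp

theorem sumFn {a : ∀ i, Fin (N i) → ℚ} (ha : PolyTime sz e fun i => List.ofFn (a i)) :
    PolyTime sz e fun i => ∑ j, a i j := by
  refine (foldFn (acc := fun i j => ((List.ofFn (a i)).take j).sum) ha
    ((ha.const 0).congr fun i => by simp)
    ((((PolyBdd.const 1).add ((PolyBdd.const 2).mul ha.bdd)).reindex Sigma.fst).mono fun x => ?_)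
    fun hx => ?_).congr fun i => ?_
  · refine (Data.size_num_sum_le _).trans ?_
    have := DataEnc.size_sublist (List.take_sublist x.2 (List.ofFn (a x.1)))
    exact Nat.add_le_add_left (Nat.mul_le_mul_left 2 this) 1
  · exact (hx.snd.add hx.fst).congr fun x => by simp only [List.take_ofFn_succ]; simp
  · rw [List.take_ofFn_self, List.sum_ofFn]

theorem minFn {a : ∀ i, Fin (N i) → ℚ} (ha : PolyTime sz e fun i => List.ofFn (a i)) :
    PolyTime sz e fun i => (List.ofFn (a i)).minD := by
  refine (foldFn
    (acc := fun i j => ((List.ofFn (a i)).take j).foldl min ((List.ofFn (a i)).headD 0)) ha ?_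
    (((ha.bdd.add (.const 2)).reindex Sigma.fst).mono fun x => ?_) fun hx => ?_).congr
      fun i => ?_
  · refine (ha.op .fst size_op_fst).of_enc_eq fun i => ?_
    cases h : List.ofFn (a i) <;> rfl
  · rcases List.mem_cons.1 (List.foldl_min_mem ((List.ofFn (a x.1)).take x.2)
      ((List.ofFn (a x.1)).headD 0)) with h | h
    · rw [h]
      cases List.ofFn (a x.1) with
      | nil => exact Nat.le_add_left 2 _
      | cons a l => exact (DataEnc.size_mem (by simp)).trans (Nat.le_add_right _ _)
    · exact (DataEnc.size_mem (List.mem_of_mem_take h)).trans (Nat.le_add_right _ _)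
  · refine ((hx.snd.le hx.fst).cond hx.snd hx.fst).congr fun x => ?_
    simp only [List.take_ofFn_succ, List.foldl_append, List.foldl_cons, List.foldl_nil]
    generalize ((List.ofFn (a x.1)).take x.2).foldl min _ = b
    by_cases h : b ≤ a x.1 x.2
    · simp [h]
    · simp [h, (not_le.1 h).le]
  · rw [List.take_ofFn_self, List.minD]

/-- The numbers `0, …, n - 1`. -/
theorem range {n : I → ℕ} (hn : PolyTime sz e fun i => (n i : ℚ)) (hb : PolyBdd sz n) :
    PolyTime sz e fun i => List.ofFn fun j : Fin (n i) => ((j : ℕ) : ℚ) := by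
  let L (i : I) : List ℚ := List.ofFn fun j : Fin (n i) => ((j : ℕ) : ℚ)
  let s (i : I) (j : ℕ) : ℚ × List ℚ := ((n i - j : ℕ), (L i).drop (n i - j))
  have hsize {a b : ℕ} (h : a ≤ b) : (enc (a : ℚ)).size ≤ 1 + 2 * (b + 1) := by
    refine Data.size_num_le_of_mag_lt (lt_of_le_of_lt ?_ Nat.lt_two_pow_self)
    simp [Rat.mag, h]
  have hL : PolyBdd sz fun i => (enc (L i)).size :=
    ((PolyBdd.const 2).add (hb.mul ((PolyBdd.const 1).add
      ((PolyBdd.const 1).add ((PolyBdd.const 2).mul (hb.add (.const 1))))))).mono fun i =>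
      (DataEnc.size_list_le (B := 1 + 2 * (n i + 1)) fun x hx => by
        obtain ⟨j, rfl⟩ := (List.mem_ofFn ..).1 hx
        exact hsize j.2.le).trans (by simp [L])
  have hbdd : PolyBdd (fun x : Σ i, Fin (n i + 1) => sz x.1) fun x => (enc (s x.1 x.2)).size :=
    ((((PolyBdd.const 1).add ((PolyBdd.const 1).add ((PolyBdd.const 2).mul
      (hb.add (.const 1))))).add hL).reindex Sigma.fst).mono fun x => by
        have h₁ := DataEnc.size_sublist (List.drop_sublist (n x.1 - x.2) (L x.1))
        have h₂ := hsize (Nat.sub_le (n x.1) x.2)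
        have h : (enc (s x.1 x.2)).size = 1 + (enc ((n x.1 - x.2 : ℕ) : ℚ)).size +
          (enc ((L x.1).drop (n x.1 - x.2))).size := rfl
        omega
  have hs : PolyTime (fun x : Σ i, Fin (n i + 1) => sz x.1) (fun x => enc (s x.1 x.2))
    (fun x => s x.1 x.2) := env hbdd
  have hs' : PolyTime (fun x : Σ i, Fin (n i) => sz x.1) (fun x => enc (s x.1 x.2))
    (fun x => s x.1 x.2) := env
      (hbdd.reindex fun x : Σ i, Fin (n i) => (⟨x.1, x.2.castSucc⟩ : Σ i, Fin (n i + 1)))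
  have hpred : PolyTime (fun x : Σ i, Fin (n i) => sz x.1) (fun x => enc (s x.1 x.2))
      (fun x => ((n x.1 - (x.2 + 1) : ℕ) : ℚ)) :=
    (hs'.fst.sub (hs'.const 1)).congr fun x => by
      have := x.2.2
      simp only [s]
      rw [show n x.1 - x.2 = n x.1 - (x.2 + 1) + 1 by omega]
      push_cast
      ring
  have hl := loop hb (s := fun i j => enc (s i j))
    (((hs.const 1).le hs.fst).congr fun x => by
      simp only [s, Nat.one_le_cast]
      exact decide_eq_decide.2 (by omega))
    (hpred.pair ((hpred.cons hs'.snd).congr (f' := fun x => (L x.1).drop (n x.1 - (x.2 + 1)))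
      fun x => by
        have h := List.drop_ofFn_eq_cons (fun j : Fin (n x.1) => ((j : ℕ) : ℚ))
          ⟨n x.1 - (x.2 + 1), by omega⟩
        simp only [s, L]
        rw [h, show n x.1 - x.2 = n x.1 - (x.2 + 1) + 1 by omega]))
  have h0 : PolyTime sz e fun i => s i 0 :=
    (hn.pair hn.nil).congr fun i => by simp [s, L]
  have h1 : PolyTime sz e fun i => s i (n i) := h0.comp hl
  exact h1.snd.congr fun i => by simp [s, L]

/-- Repeating a step `n i` times, where `acc i j` is the value after `j` steps. -/
theorem iterate {n : I → ℕ} {acc : I → ℕ → α}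
    (hn : PolyTime sz e fun i => (n i : ℚ)) (hb : PolyBdd sz n)
    (h0 : PolyTime sz e fun i => acc i 0)
    (hacc : PolyBdd (fun x : Σ i, Fin (n i + 1) => sz x.1) fun x => (enc (acc x.1 x.2)).size)
    (hstep : PolyTime (fun x : Σ i, Fin (n i) => sz x.1)
        (fun x => .pair (e x.1) (enc (((x.2 : ℕ) : ℚ), acc x.1 x.2)))
        (fun x => acc x.1 x.2) →
      PolyTime (fun x : Σ i, Fin (n i) => sz x.1)
        (fun x => .pair (e x.1) (enc (((x.2 : ℕ) : ℚ), acc x.1 x.2))) fun x => acc x.1 (x.2 + 1)) :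
    PolyTime sz e fun i => acc i (n i) :=
  foldFn (range hn hb) h0 hacc fun hx => hstep hx.snd

/-- Pairing the entries of two lists, where the second one is continued by leaves `0`. -/
theorem padZip {a : ∀ i, Fin (N i) → α} {l : I → List Data}
    (ha : PolyTime sz e fun i => List.ofFn (a i)) (hl : PolyTime sz e l) :
    PolyTime sz e fun i => List.ofFn fun j => (a i j, (l i).getD j (.num 0)) := by
  let L (i : I) : List (α × Data) := List.ofFn fun j => (a i j, (l i).getD j (.num 0))
  have hN : PolyBdd sz N := ha.bdd_length.mono fun i => by simp
  have hL : PolyBdd sz fun i => (enc (L i)).size := by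
    refine ((PolyBdd.const 2).add (hN.mul ((PolyBdd.const 1).add (((PolyBdd.const 3).add
      ha.bdd).add hl.bdd)))).mono fun i => (DataEnc.size_list_le fun x hx => ?_).trans
        (b := 2 + (L i).length * (1 + (3 + (enc (List.ofFn (a i))).size + (enc (l i)).size)))
        le_rfl |>.trans (by simp [L])
    obtain ⟨j, rfl⟩ := (List.mem_ofFn ..).1 hx
    have h₁ : (enc (a i j)).size ≤ (enc (List.ofFn (a i))).size :=
      DataEnc.size_mem (by simp [List.mem_ofFn])
    have h₂ : ((l i).getD j (.num 0)).size ≤ 2 + (enc (l i)).size := by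
      by_cases h : (j : ℕ) < (l i).length
      · rw [List.getD_eq_getElem _ _ h]
        exact (DataEnc.size_mem (l := l i) (List.getElem_mem h)).trans (Nat.le_add_left _ _)
      · rw [List.getD_eq_default _ _ (not_lt.1 h), Data.size_zero]
        exact Nat.le_add_right _ _
    have h : (enc (a i j, (l i).getD j (.num 0))).size =
      1 + (enc (a i j)).size + ((l i).getD j (.num 0)).size := rfl
    omega
  refine (foldFn (acc := fun i j => ((l i).drop j, ((L i).take j).reverse)) ha (hl.pair hl.nil)
    ((((PolyBdd.const 1).add (hl.bdd.add hL)).reindex Sigma.fst).mono fun x => ?_) fun hx => ?_)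
    |>.snd.reverse.congr fun i => ?_
  · have h : (enc ((l x.1).drop x.2, ((L x.1).take x.2).reverse)).size =
      1 + (enc ((l x.1).drop x.2)).size + (enc ((L x.1).take x.2).reverse).size := rfl
    have h₁ := DataEnc.size_sublist (List.drop_sublist x.2 (l x.1))
    have h₂ := DataEnc.size_sublist (List.take_sublist x.2 (L x.1))
    rw [DataEnc.size_reverse] at h
    omega
  · refine (hx.snd.fst.tail.pair ((hx.fst.pair hx.snd.fst.headD).cons hx.snd.snd)).congr
      fun x => ?_
    simp only [L, List.take_ofFn_succ]
    simp [List.headD_eq_head?_getD, List.getD_eq_getElem?_getD]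
  · rw [List.take_of_length_le (by simp [L])]
    simp [L]

theorem zipFn {a : ∀ i, Fin (N i) → α} {b : ∀ i, Fin (N i) → β}
    (ha : PolyTime sz e fun i => List.ofFn (a i)) (hb : PolyTime sz e fun i => List.ofFn (b i)) :
    PolyTime sz e fun i => List.ofFn fun j => (a i j, b i j) :=
  (padZip ha (l := fun i => List.ofFn fun j => enc (b i j)) (hb.of_enc_eq fun i => by
    simp only [enc, List.map_ofFn]; rfl)).of_enc_eq fun i => by
      simp only [enc, List.map_ofFn]
      congr 2
      funext j
      simp

theorem padFn {a : ∀ i, Fin (N i) → α} {l : I → List ℚ}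
    (ha : PolyTime sz e fun i => List.ofFn (a i)) (hl : PolyTime sz e l) :
    PolyTime sz e fun i => List.ofFn fun j => (a i j, (l i).getD j 0) :=
  (padZip ha (l := fun i => (l i).map enc) (hl.of_enc_eq fun i => by
    simp [enc])).of_enc_eq fun i => by
      simp only [enc, List.map_ofFn]
      congr 2
      funext j
      simp [List.getD_eq_getElem?_getD, List.getElem?_map]

theorem filterFn {a : ∀ i, Fin (N i) → α} {c : ∀ i, Fin (N i) → Bool}
    (ha : PolyTime sz e fun i => List.ofFn (a i))
    (hc : PolyTime (fun x : Σ i, Fin (N i) => sz x.1) (fun x => .pair (e x.1) (enc (a x.1 x.2)))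
        (fun x => a x.1 x.2) →
      PolyTime (fun x : Σ i, Fin (N i) => sz x.1) (fun x => .pair (e x.1) (enc (a x.1 x.2)))
        fun x => c x.1 x.2) :
    PolyTime sz e fun i => ((List.finRange (N i)).filter (c i)).map (a i) := by
  refine (mapFn (b := fun i j => bif c i j then [a i j] else []) ha fun hx =>
    (hc hx).cond (hx.cons hx.nil) hx.nil).flatten.congr fun i => ?_
  rw [List.ofFn_eq_map]
  induction List.finRange (N i) with
  | nil => rfl
  | cons j l ih =>
    rw [List.map_cons, List.flatten_cons, ih]
    cases h : c i j <;> simp [h]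

theorem map {l : I → List α} {b : I → α → β} (hl : PolyTime sz e l)
    (hb : PolyTime (fun x : Σ i, Fin (l i).length => sz x.1)
        (fun x => .pair (e x.1) (enc ((l x.1).get x.2))) (fun x => (l x.1).get x.2) →
      PolyTime (fun x : Σ i, Fin (l i).length => sz x.1)
        (fun x => .pair (e x.1) (enc ((l x.1).get x.2))) fun x => b x.1 ((l x.1).get x.2)) :
    PolyTime sz e fun i => (l i).map (b i) :=
  (mapFn (a := fun i => (l i).get) (hl.congr fun i => by simp) hb).congr fun i => by
    conv_rhs => rw [← List.ofFn_get (l i), List.map_ofFn]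

theorem filter {l : I → List α} {c : I → α → Bool} (hl : PolyTime sz e l)
    (hc : PolyTime (fun x : Σ i, Fin (l i).length => sz x.1)
        (fun x => .pair (e x.1) (enc ((l x.1).get x.2))) (fun x => (l x.1).get x.2) →
      PolyTime (fun x : Σ i, Fin (l i).length => sz x.1)
        (fun x => .pair (e x.1) (enc ((l x.1).get x.2))) fun x => c x.1 ((l x.1).get x.2)) :
    PolyTime sz e fun i => (l i).filter (c i) :=
  (filterFn (a := fun i => (l i).get) (hl.congr fun i => by simp) hc).congr fun i => by
    conv_rhs => rw [← List.ofFn_get (l i), List.ofFn_eq_map, List.filter_map]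

theorem sum {l : I → List ℚ} (hl : PolyTime sz e l) : PolyTime sz e fun i => (l i).sum :=
  (sumFn (a := fun i => (l i).get) (hl.congr fun i => by simp)).congr fun i => by
    rw [← List.sum_ofFn, List.ofFn_get]

theorem length {l : I → List α} (hl : PolyTime sz e l) :
    PolyTime sz e fun i => ((l i).length : ℚ) :=
  (hl.map (b := fun _ _ => (1 : ℚ)) fun hx => hx.const 1).sum.congr fun i => by simp

end PolyTime

/-! ### The `k` smallest entries of a list -/

/-- The number of indices that precede `t` when the indices are ordered by the values of `f` and
indices with equal values by their position. -/
def indexRank {N : ℕ} (f : Fin N → ℚ) (t : Fin N) : ℕ :=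
  (Finset.univ.filter fun u => f u < f t ∨ f u = f t ∧ u < t).card

theorem indexRank_lt_indexRank {N : ℕ} {f : Fin N → ℚ} {u t : Fin N}
    (h : f u < f t ∨ f u = f t ∧ u < t) : indexRank f u < indexRank f t := by
  refine Finset.card_lt_card ⟨fun w hw => ?_, fun hsub => ?_⟩
  · simp only [Finset.mem_filter, Finset.mem_univ, true_and] at hw ⊢
    grind
  · have := hsub (Finset.mem_filter.2 ⟨Finset.mem_univ u, h⟩)
    simp at this

theorem indexRank_lt {N : ℕ} (f : Fin N → ℚ) (t : Fin N) : indexRank f t < N := by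
  have : indexRank f t < (Finset.univ : Finset (Fin N)).card := by
    refine Finset.card_lt_card (Finset.ssubset_univ_iff.2 fun h => ?_)
    have := h ▸ Finset.mem_univ t
    simp at this
  simpa using this

theorem indexRank_injective {N : ℕ} (f : Fin N → ℚ) : Function.Injective (indexRank f) := by
  intro u t h
  by_contra hne
  rcases lt_trichotomy (f u) (f t) with h' | h' | h'
  · exact (indexRank_lt_indexRank (.inl h')).ne h
  · rcases lt_or_gt_of_ne hne with h'' | h''
    · exact (indexRank_lt_indexRank (.inr ⟨h', h''⟩)).ne h
    · exact (indexRank_lt_indexRank (.inr ⟨h'.symm, h''⟩)).ne h.symm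
  · exact (indexRank_lt_indexRank (.inl h')).ne h.symm

/-- The ranks are `0, …, N - 1`, each of them attained once. -/
theorem card_indexRank_lt {N : ℕ} (f : Fin N → ℚ) (k : ℕ) :
    (Finset.univ.filter fun t => indexRank f t < k).card = min k N := by
  have hinj : Function.Injective fun t => (⟨indexRank f t, indexRank_lt f t⟩ : Fin N) :=
    fun u t h => indexRank_injective f (Fin.mk.inj_iff.1 h)
  have hbij := Finite.injective_iff_bijective.1 hinj
  have h1 : (Finset.univ.filter fun t => indexRank f t < k).card =
      (Finset.univ.filter fun r : Fin N => (r : ℕ) < k).card :=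
    Finset.card_bijective _ hbij fun t => by simp
  rw [h1, Fin.card_filter_val_lt]
  exact min_comm _ _

/-- The `k` entries of `C` with the smallest values of `v`, in the order in which they appear in
`C`. Ties are broken in favour of earlier entries. -/
def List.kSmallest {α : Type*} (k : ℕ) (v : α → ℚ) (C : List α) : List α :=
  ((List.finRange C.length).filter fun t =>
    decide (indexRank (fun u => v (C.get u)) t < k)).map C.get

section kSmallest

variable {α : Type*} {k : ℕ} {v : α → ℚ} {C : List α}

theorem List.kSmallest_sublist : (C.kSmallest k v).Sublist C := by
  have := (List.filter_sublist (l := List.finRange C.length) (p := fun t =>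
    decide (indexRank (fun u => v (C.get u)) t < k))).map C.get
  rwa [← List.ofFn_eq_map, List.ofFn_get] at this

theorem List.length_kSmallest : (C.kSmallest k v).length = min k C.length := by
  rw [List.kSmallest, List.length_map, ← card_indexRank_lt fun u => v (C.get u)]
  rw [← List.toFinset_card_of_nodup ((List.nodup_finRange _).filter _)]
  congr 1
  ext t
  simp

theorem List.mem_kSmallest {a : α} : a ∈ C.kSmallest k v ↔
    ∃ t, indexRank (fun u => v (C.get u)) t < k ∧ C.get t = a := by
  simp [List.kSmallest]

theorem List.le_indexRank_of_notMem_kSmallest {u : Fin C.length}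
    (h : C.get u ∉ C.kSmallest k v) : k ≤ indexRank (fun u => v (C.get u)) u := by
  by_contra! h'
  exact h (List.mem_kSmallest.2 ⟨u, h', rfl⟩)

theorem List.length_kSmallest_of_notMem {c : α} (hc : c ∈ C) (hc' : c ∉ C.kSmallest k v) :
    (C.kSmallest k v).length = k := by
  obtain ⟨u, rfl⟩ := List.mem_iff_get.1 hc
  rw [List.length_kSmallest,
    min_eq_left ((List.le_indexRank_of_notMem_kSmallest hc').trans (indexRank_lt _ u).le)]

theorem List.le_of_notMem_kSmallest {b c : α} (hb : b ∈ C.kSmallest k v) (hc : c ∈ C)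
    (hc' : c ∉ C.kSmallest k v) : v b ≤ v c := by
  obtain ⟨u, rfl⟩ := List.mem_iff_get.1 hc
  obtain ⟨t, ht, rfl⟩ := List.mem_kSmallest.1 hb
  by_contra! h
  have := indexRank_lt_indexRank (f := fun u => v (C.get u)) (.inl h)
  have := List.le_indexRank_of_notMem_kSmallest hc'
  omega

theorem List.card_lt_of_mem_kSmallest [DecidableEq α] {b : α} (hb : b ∈ C.kSmallest k v)
    (S : Finset α) (hS : ∀ c ∈ S, c ∈ C ∧ v c < v b) : S.card < k := by
  obtain ⟨t, ht, rfl⟩ := List.mem_kSmallest.1 hb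
  refine lt_of_le_of_lt ?_ ht
  refine (Finset.card_le_card fun c hc => ?_).trans (Finset.card_image_le (f := C.get))
  obtain ⟨u, hu⟩ := List.mem_iff_get.1 (hS c hc).1
  subst hu
  exact Finset.mem_image_of_mem _ (Finset.mem_filter.2 ⟨Finset.mem_univ u, .inl (hS _ hc).2⟩)

end kSmallest

/-! ### Beam search in the binary tree -/

/-- Lists of signs of length `n`. The sign `1` stands for the bit `0`, the sign `-1` for the bit
`1`. -/
def IsSignList (n : ℕ) (p : List ℚ) : Prop :=
  p.length = n ∧ ∀ s ∈ p, s = 1 ∨ s = -1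

/-- The lists `p` and `q` differ, and `p` has sign `1` and `q` has sign `-1` in the first position
where they do: the bits of `p` are lexicographically smaller than those of `q`. -/
def SignLt (p q : List ℚ) : Prop :=
  ∃ l p' q', p = l ++ 1 :: p' ∧ q = l ++ -1 :: q'

theorem SignLt.append {p q : List ℚ} (h : SignLt p q) (x y : List ℚ) :
    SignLt (p ++ x) (q ++ y) := by
  obtain ⟨l, p', q', rfl, rfl⟩ := h
  exact ⟨l, p' ++ x, q' ++ y, by simp, by simp⟩

theorem SignLt.ne {p q : List ℚ} (h : SignLt p q) : p ≠ q := by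
  obtain ⟨l, p', q', rfl, rfl⟩ := h
  intro h
  have := (List.cons.inj (List.append_cancel_left h)).1
  norm_num at this

/-- The children of the nodes in `B`. -/
def signChildren (B : List (List ℚ)) : List (List ℚ) :=
  B.flatMap fun p => [p ++ [1], p ++ [-1]]

/-- The nodes of level `j` that the beam search keeps: the `k` children of the nodes kept on the
level above that have the smallest values. -/
def beam (k : ℕ) (v : List ℚ → ℚ) : ℕ → List (List ℚ)
  | 0 => [[]]
  | j + 1 => (signChildren (beam k v j)).kSmallest k v

section Beam

variable {k : ℕ} {v : List ℚ → ℚ}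

theorem isSignList_of_mem_beam {j : ℕ} {p : List ℚ} (hp : p ∈ beam k v j) : IsSignList j p := by
  induction j generalizing p with
  | zero => simp_all [beam, IsSignList]
  | succ j ih =>
    have := List.kSmallest_sublist.subset hp
    simp only [signChildren, List.mem_flatMap, List.mem_cons, List.not_mem_nil, or_false] at this
    obtain ⟨a, ha, h⟩ := this
    obtain ⟨h₁, h₂⟩ := ih ha
    rcases h with rfl | rfl
    all_goals
      refine ⟨by simp [h₁], fun s hs => ?_⟩
      rcases List.mem_append.1 hs with hs | hs
      · exact h₂ s hs
      · simp_all

theorem pairwise_beam (j : ℕ) : (beam k v j).Pairwise SignLt := by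
  induction j with
  | zero => simp [beam]
  | succ j ih =>
    refine List.Pairwise.sublist List.kSmallest_sublist
      (List.pairwise_flatMap.2 ⟨fun p _ => ?_, ?_⟩)
    · simpa using ⟨p, [], [], rfl, rfl⟩
    · refine ih.imp fun h x hx y hy => ?_
      simp only [List.mem_cons, List.not_mem_nil, or_false] at hx hy
      rcases hx with rfl | rfl <;> rcases hy with rfl | rfl <;> exact h.append _ _

theorem nodup_beam (j : ℕ) : (beam k v j).Nodup := (pairwise_beam j).imp SignLt.ne

theorem length_beam_le (j : ℕ) : (beam k v j).length ≤ max 1 k := by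
  cases j with
  | zero => simp [beam]
  | succ j => simp [beam, List.length_kSmallest]

/-- What the beam search drops is no better than anything it keeps, provided that the value of a
node is the smaller one of the values of its children. A kept node that is worse than a dropped
descendant of a dropped node would be preceded by a child of each of the `k` nodes that were
kept one level above. -/
theorem le_of_notMem_beam {m : ℕ}
    (hle : ∀ p s, p.length < m → (s = 1 ∨ s = -1) → v p ≤ v (p ++ [s]))
    (hex : ∀ p, p.length < m → ∃ s, (s = 1 ∨ s = -1) ∧ v (p ++ [s]) ≤ v p)
    {j : ℕ} (hj : j ≤ m) {w : List ℚ} (hw : IsSignList j w) (hw' : w ∉ beam k v j) :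
    (beam k v j).length = k ∧ ∀ b ∈ beam k v j, v b ≤ v w := by
  induction j generalizing w with
  | zero =>
    have := List.length_eq_zero_iff.1 hw.1
    simp_all [beam]
  | succ j ih =>
    obtain ⟨p, s, rfl⟩ : ∃ p s, w = p ++ [s] := by
      rcases List.eq_nil_or_concat' w with rfl | h
      · simp [IsSignList] at hw
      · exact h
    have hp : IsSignList j p := ⟨by simpa using hw.1, fun x hx => hw.2 x (by simp [hx])⟩
    have hs : s = 1 ∨ s = -1 := hw.2 s (by simp)
    have hmem {p s} (hp : p ∈ beam k v j) (hs : s = 1 ∨ s = -1) :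
        p ++ [s] ∈ signChildren (beam k v j) :=
      List.mem_flatMap.2 ⟨p, hp, by rcases hs with rfl | rfl <;> simp⟩
    by_cases hpB : p ∈ beam k v j
    · exact ⟨List.length_kSmallest_of_notMem (hmem hpB hs) hw',
        fun b hb => List.le_of_notMem_kSmallest hb (hmem hpB hs) hw'⟩
    · obtain ⟨hlen, hb⟩ := ih (by omega) hp hpB
      have hlen' : (signChildren (beam k v j)).length = k * 2 := by
        simp [signChildren, List.length_flatMap, hlen]
      refine ⟨by rw [beam, List.length_kSmallest]; omega, fun b' hb' => ?_⟩
      by_contra! hlt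
      choose! σ hσ using hex
      have hinj : Function.Injective fun q : List ℚ => q ++ [σ q] :=
        fun q q' h => (List.append_inj' h rfl).1
      have hS := List.card_lt_of_mem_kSmallest hb'
        ((beam k v j).toFinset.image fun q => q ++ [σ q]) fun c hc => by
          obtain ⟨q, hq, rfl⟩ := Finset.mem_image.1 hc
          rw [List.mem_toFinset] at hq
          have hqm : q.length < m := by rw [(isSignList_of_mem_beam hq).1]; omega
          refine ⟨hmem hq (hσ q hqm).1, lt_of_le_of_lt ?_ hlt⟩
          exact (hσ q hqm).2.trans ((hb q hq).trans (hle p s (by rw [hp.1]; omega) hs))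
      rw [Finset.card_image_of_injective _ hinj, List.toFinset_card_of_nodup (nodup_beam j),
        hlen] at hS
      exact hS.false

theorem Finset.sum_le_sum_of_card_eq_of_forall_notMem {α : Type*} [DecidableEq α] {B Z : Finset α}
    {v : α → ℚ} (hcard : B.card = Z.card) (h : ∀ b ∈ B, ∀ z ∈ Z, z ∉ B → v b ≤ v z) :
    ∑ b ∈ B, v b ≤ ∑ z ∈ Z, v z := by
  rw [← Finset.sum_inter_add_sum_sdiff B Z, ← Finset.sum_inter_add_sum_sdiff Z B,
    Finset.inter_comm Z B]
  have hc : (B \ Z).card = (Z \ B).card := Finset.card_sdiff_comm hcard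
  have e := Finset.equivOfCardEq hc
  rw [← Finset.sum_coe_sort (B \ Z), ← Finset.sum_coe_sort (Z \ B), ← e.sum_comp]
  gcongr with b
  have hz := Finset.mem_sdiff.1 (e b).2
  exact h _ (Finset.mem_sdiff.1 b.2).1 _ hz.1 hz.2

/-- The last level of the beam search compared with any `k` leaves: it consists of `k` leaves, each
of which is at least as good as some given one, and has at most the same total value. -/
theorem beam_optimal (hk : 1 ≤ k) {m : ℕ}
    (hle : ∀ p s, p.length < m → (s = 1 ∨ s = -1) → v p ≤ v (p ++ [s]))
    (hex : ∀ p, p.length < m → ∃ s, (s = 1 ∨ s = -1) ∧ v (p ++ [s]) ≤ v p)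
    (Z : Finset (List ℚ)) (hZ : ∀ z ∈ Z, IsSignList m z) (hcard : Z.card = k) :
    (beam k v m).length = k ∧ (∀ b ∈ beam k v m, ∃ z ∈ Z, v b ≤ v z) ∧
      ((beam k v m).map v).sum ≤ ∑ z ∈ Z, v z := by
  have hcover {w} (hw : w ∈ Z) (hw' : w ∉ beam k v m) :=
    le_of_notMem_beam hle hex le_rfl (hZ w hw) hw'
  have hB := List.toFinset_card_of_nodup (nodup_beam (k := k) (v := v) m)
  have hlen : (beam k v m).length = k := by
    by_cases h : ∀ w ∈ Z, w ∈ beam k v m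
    · have h₁ := Finset.card_le_card (s := Z) (t := (beam k v m).toFinset) fun w hw => by
        simpa using h w hw
      have h₂ := length_beam_le (k := k) (v := v) m
      omega
    · push Not at h
      obtain ⟨w, hw, hw'⟩ := h
      exact (hcover hw hw').1
  refine ⟨hlen, fun b hb => ?_, ?_⟩
  · by_cases h : ∀ w ∈ Z, w ∈ beam k v m
    · have h₁ : Z = (beam k v m).toFinset := Finset.eq_of_subset_of_card_le
        (fun w hw => by simpa using h w hw) (by omega)
      exact ⟨b, by simpa [h₁] using hb, le_rfl⟩
    · push Not at h
      obtain ⟨w, hw, hw'⟩ := h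
      exact ⟨w, hw, (hcover hw hw').2 b hb⟩
  · rw [← List.sum_toFinset _ (nodup_beam m)]
    refine Finset.sum_le_sum_of_card_eq_of_forall_notMem (by omega) fun b hb z hz hz' => ?_
    rw [List.mem_toFinset] at hb hz'
    exact (hcover hz hz').2 b hb

end Beam

/-! ### Values of nodes -/

section NodeValue

variable {m r : ℕ}

/-- The number of positions of the list `p` in which the signs of the binary vector `w` differ from
those in `p`. Each term is an affine function of `w`, and is zero beyond the end of `p`. -/
def signDist (p : List ℚ) (w : Fin m → ℚ) : ℚ :=
  ∑ j : Fin m, p.getD j 0 * (w j - (1 - p.getD j 0) * (1 / 2))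

/-- The binary vector of a list of `m` signs. -/
def signBits (m : ℕ) (p : List ℚ) : Fin m → ℚ := fun j => (1 - p.getD j 0) * (1 / 2)

theorem IsSignList.getD {p : List ℚ} (hp : IsSignList m p) (j : Fin m) :
    p.getD j 0 = 1 ∨ p.getD j 0 = -1 := by
  rw [List.getD_eq_getElem _ _ (by rw [hp.1]; exact j.2)]
  exact hp.2 _ (List.getElem_mem _)

theorem signDist_append {p : List ℚ} (hp : p.length < m) (s : ℚ) (w : Fin m → ℚ) :
    signDist (p ++ [s]) w = signDist p w + s * (w ⟨p.length, hp⟩ - (1 - s) * (1 / 2)) := by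
  have h (j : Fin m) : (p ++ [s]).getD j 0 * (w j - (1 - (p ++ [s]).getD j 0) * (1 / 2)) =
      p.getD j 0 * (w j - (1 - p.getD j 0) * (1 / 2)) +
        if j = ⟨p.length, hp⟩ then s * (w j - (1 - s) * (1 / 2)) else 0 := by
    rcases lt_trichotomy (j : ℕ) p.length with h | h | h
    · simp [List.getD_eq_getElem?_getD, List.getElem?_append, h, Fin.ext_iff, h.ne]
    · simp [List.getD_eq_getElem?_getD, h, Fin.ext_iff]
    · have h' : (p ++ [s]).length ≤ (j : ℕ) := by simp; omega
      rw [List.getD_eq_default _ _ h', List.getD_eq_default _ _ h.le]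
      simp [Fin.ext_iff, h.ne']
  simp only [signDist, h, Finset.sum_add_distrib, Finset.sum_ite_eq', Finset.mem_univ, if_true]

theorem signDist_signBits (p : List ℚ) : signDist p (signBits m p) = 0 := by
  simp [signDist, signBits]

theorem one_le_signDist {p : List ℚ} (hp : IsSignList m p) {w : Fin m → ℚ}
    (hw : ∀ j, w j = 0 ∨ w j = 1) (hne : w ≠ signBits m p) : 1 ≤ signDist p w := by
  obtain ⟨j, hj⟩ := Function.ne_iff.1 hne
  have hterm (i : Fin m) : 0 ≤ p.getD i 0 * (w i - (1 - p.getD i 0) * (1 / 2)) := by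
    rcases hp.getD i with h | h <;> rcases hw i with h' | h' <;> rw [h, h'] <;> norm_num
  refine le_trans ?_ (Finset.single_le_sum (fun i _ => hterm i) (Finset.mem_univ j))
  unfold signBits at hj
  rcases hp.getD j with h | h <;> rcases hw j with h' | h' <;> rw [h, h'] at hj ⊢ <;> norm_num at *

/-- The value of the affine function `z ↦ c ⬝ᵥ z + d`, increased by `M` times the distance from `p`,
at the point that the function `opt` returns for its linear part. -/
def branchVal (opt : (Fin m → ℚ) → List ℚ) (M : ℚ) (c : Fin m → ℚ) (d : ℚ) (p : List ℚ) : ℚ :=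
  ∑ j : Fin m, (c j * (opt fun j => c j + M * p.getD j 0).getD j 0 + M * (p.getD j 0 *
    ((opt fun j => c j + M * p.getD j 0).getD j 0 - (1 - p.getD j 0) * (1 / 2)))) + d

/-- The least value of the affine functions `z ↦ c q ⬝ᵥ z + d q`, each of them increased by `M`
times the distance from `p`. -/
def nodeVal (opt : (Fin m → ℚ) → List ℚ) (M : ℚ) (c : Fin r → Fin m → ℚ) (d : Fin r → ℚ)
    (p : List ℚ) : ℚ :=
  (List.ofFn fun q => branchVal opt M (c q) (d q) p).minD

/-- For every `c`, the value of `c` at the point with entries `opt c` is its minimum over `W`. The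
point itself need not be in `W`. -/
def IsMinimizer (W : Set (Fin m → ℚ)) (opt : (Fin m → ℚ) → List ℚ) : Prop :=
  ∀ c, (∀ w ∈ W, ∑ j : Fin m, c j * (opt c).getD j 0 ≤ ∑ j, c j * w j) ∧
    ∃ w ∈ W, ∑ j : Fin m, c j * (opt c).getD j 0 = ∑ j, c j * w j

variable {W : Set (Fin m → ℚ)} {opt : (Fin m → ℚ) → List ℚ} {M : ℚ} {c : Fin r → Fin m → ℚ}
  {d : Fin r → ℚ}

/-- The number that `branchVal` and `nodeVal` minimize. -/
theorem sum_add_eq_penalized (M : ℚ) (c : Fin m → ℚ) (d : ℚ) (p : List ℚ) (w : Fin m → ℚ) :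
    ∑ j : Fin m, (c j * w j + M * (p.getD j 0 * (w j - (1 - p.getD j 0) * (1 / 2)))) + d =
      c ⬝ᵥ w + d + M * signDist p w := by
  simp only [Finset.sum_add_distrib, dotProduct, signDist, Finset.mul_sum]
  ring

theorem branchVal_isLeast (hopt : IsMinimizer W opt) (M : ℚ) (c : Fin m → ℚ) (d : ℚ)
    (p : List ℚ) : IsLeast ((fun w => c ⬝ᵥ w + d + M * signDist p w) '' W)
      (branchVal opt M c d p) := by
  obtain ⟨h₁, w, hw, h₂⟩ := hopt fun j => c j + M * p.getD j 0
  -- Both sides of the comparison are linear in the point, up to the same constant.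
  have key (z : Fin m → ℚ) :
      ∑ j : Fin m, (c j * z j + M * (p.getD j 0 * (z j - (1 - p.getD j 0) * (1 / 2)))) + d =
        ∑ j : Fin m, (c j + M * p.getD j 0) * z j +
          (d - M * ∑ j : Fin m, p.getD j 0 * ((1 - p.getD j 0) * (1 / 2))) := by
    rw [Finset.mul_sum, ← add_sub_assoc, add_sub_right_comm, ← Finset.sum_sub_distrib]
    congr 1
    exact Finset.sum_congr rfl fun j _ => by ring
  constructor
  · refine ⟨w, hw, ?_⟩
    simp only [← sum_add_eq_penalized]
    rw [branchVal, key, key fun j => (opt _).getD j 0, h₂]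
  · rintro _ ⟨w', hw', rfl⟩
    simp only [← sum_add_eq_penalized]
    rw [branchVal, key, key]
    exact add_le_add_left (h₁ w' hw') _

theorem nodeVal_isLeast (hr : 0 < r) (hopt : IsMinimizer W opt) (M : ℚ) (c : Fin r → Fin m → ℚ)
    (d : Fin r → ℚ) (p : List ℚ) :
    (∀ q, ∀ w ∈ W, nodeVal opt M c d p ≤ c q ⬝ᵥ w + d q + M * signDist p w) ∧
      ∃ q, ∃ w ∈ W, nodeVal opt M c d p = c q ⬝ᵥ w + d q + M * signDist p w := by
  have hmin := List.minD_isLeast (l := List.ofFn fun q => branchVal opt M (c q) (d q) p)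
    (by simp [hr.ne'])
  constructor
  · intro q w hw
    refine (hmin.2 ((List.mem_ofFn ..).2 ⟨q, rfl⟩)).trans ?_
    exact (branchVal_isLeast hopt M (c q) (d q) p).2 ⟨w, hw, rfl⟩
  · obtain ⟨q, hq⟩ := (List.mem_ofFn ..).1 hmin.1
    obtain ⟨w, hw, h⟩ := (branchVal_isLeast hopt M (c q) (d q) p).1
    exact ⟨q, w, hw, by rw [nodeVal, ← hq]; exact h.symm⟩

theorem nodeVal_le_append (hr : 0 < r) (hopt : IsMinimizer W opt)
    (hW : ∀ w ∈ W, ∀ j, w j = 0 ∨ w j = 1) (hM : 0 ≤ M) (p : List ℚ) (s : ℚ) (hp : p.length < m)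
    (hs : s = 1 ∨ s = -1) : nodeVal opt M c d p ≤ nodeVal opt M c d (p ++ [s]) := by
  obtain ⟨q, w, hw, h⟩ := (nodeVal_isLeast hr hopt M c d (p ++ [s])).2
  rw [h, signDist_append hp]
  refine ((nodeVal_isLeast hr hopt M c d p).1 q w hw).trans ?_
  gcongr
  have : 0 ≤ s * (w ⟨p.length, hp⟩ - (1 - s) * (1 / 2)) := by
    rcases hs with rfl | rfl <;> rcases hW w hw ⟨p.length, hp⟩ with h' | h' <;> rw [h'] <;> norm_num
  linarith

theorem exists_nodeVal_append_le (hr : 0 < r) (hopt : IsMinimizer W opt)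
    (hW : ∀ w ∈ W, ∀ j, w j = 0 ∨ w j = 1) (p : List ℚ) (hp : p.length < m) :
    ∃ s, (s = 1 ∨ s = -1) ∧ nodeVal opt M c d (p ++ [s]) ≤ nodeVal opt M c d p := by
  obtain ⟨q, w, hw, h⟩ := (nodeVal_isLeast hr hopt M c d p).2
  rw [h]
  rcases hW w hw ⟨p.length, hp⟩ with h' | h'
  · refine ⟨1, .inl rfl, ((nodeVal_isLeast hr hopt M c d _).1 q w hw).trans ?_⟩
    rw [signDist_append hp, h']
    norm_num
  · refine ⟨-1, .inr rfl, ((nodeVal_isLeast hr hopt M c d _).1 q w hw).trans ?_⟩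
    rw [signDist_append hp, h']
    norm_num

/-- A bound on the absolute values of the affine functions `z ↦ c q ⬝ᵥ z + d q` on binary vectors;
the estimate `|a| ≤ a * a + 1` avoids absolute values. -/
def affineBound (c : Fin r → Fin m → ℚ) (d : Fin r → ℚ) : ℚ :=
  ∑ q, (∑ j, (c q j * c q j + 1) + (d q * d q + 1))

theorem abs_le_affineBound (c : Fin r → Fin m → ℚ) (d : Fin r → ℚ) {w : Fin m → ℚ}
    (hw : ∀ j, w j = 0 ∨ w j = 1) (q : Fin r) : |c q ⬝ᵥ w + d q| ≤ affineBound c d := by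
  have hsq (a : ℚ) : |a| ≤ a * a + 1 := by
    rw [← abs_mul_abs_self]
    nlinarith [sq_nonneg (|a| - 1), abs_nonneg a]
  have hpos (q : Fin r) : 0 ≤ ∑ j, (c q j * c q j + 1) + (d q * d q + 1) := by
    refine add_nonneg (Finset.sum_nonneg fun j _ => ?_) ?_ <;> nlinarith
  refine le_trans ?_ (Finset.single_le_sum (fun q _ => hpos q) (Finset.mem_univ q))
  refine (abs_add_le _ _).trans (add_le_add ?_ (hsq _))
  refine (Finset.abs_sum_le_sum_abs _ _).trans (Finset.sum_le_sum fun j _ => ?_)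
  rcases hw j with h | h
  · rw [h, mul_zero, abs_zero]
    nlinarith
  · rw [h, mul_one]
    exact hsq _

theorem affineBound_nonneg (c : Fin r → Fin m → ℚ) (d : Fin r → ℚ) : 0 ≤ affineBound c d :=
  Finset.sum_nonneg fun q _ => add_nonneg (Finset.sum_nonneg fun j _ => by nlinarith) (by nlinarith)

/-- The penalty `2 * affineBound c d + 1` is so large that the value of a leaf tells whether the
leaf is in `W`. -/
theorem mem_of_nodeVal_le (hr : 0 < r) (hopt : IsMinimizer W opt)
    (hW : ∀ w ∈ W, ∀ j, w j = 0 ∨ w j = 1) {p : List ℚ} (hp : IsSignList m p)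
    (h : nodeVal opt (2 * affineBound c d + 1) c d p ≤ affineBound c d) :
    signBits m p ∈ W ∧ ∃ q, nodeVal opt (2 * affineBound c d + 1) c d p =
      c q ⬝ᵥ signBits m p + d q := by
  obtain ⟨q, w, hw, h'⟩ := (nodeVal_isLeast hr hopt (2 * affineBound c d + 1) c d p).2
  by_cases hne : w = signBits m p
  · subst hne
    exact ⟨hw, q, by rw [h', signDist_signBits, mul_zero, add_zero]⟩
  · have h₁ := one_le_signDist hp (hW w hw) hne
    have h₂ := (abs_le.1 (abs_le_affineBound c d (hW w hw) q)).1
    nlinarith [affineBound_nonneg c d]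

theorem nodeVal_le_of_mem (hr : 0 < r) (hopt : IsMinimizer W opt) {p : List ℚ}
    (h : signBits m p ∈ W) (q : Fin r) : nodeVal opt M c d p ≤ c q ⬝ᵥ signBits m p + d q := by
  simpa [signDist_signBits] using (nodeVal_isLeast hr hopt M c d p).1 q _ h

theorem nodeVal_eq_inf' (hr : 0 < r) (hopt : IsMinimizer W opt)
    (hW : ∀ w ∈ W, ∀ j, w j = 0 ∨ w j = 1) {p : List ℚ} (hp : IsSignList m p)
    (h : signBits m p ∈ W) (hne : (Finset.univ : Finset (Fin r)).Nonempty) :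
    nodeVal opt (2 * affineBound c d + 1) c d p =
      Finset.univ.inf' hne fun q => c q ⬝ᵥ signBits m p + d q := by
  have hle : nodeVal opt (2 * affineBound c d + 1) c d p ≤ affineBound c d :=
    (nodeVal_le_of_mem hr hopt h ⟨0, hr⟩).trans
      (abs_le.1 (abs_le_affineBound c d (hW _ h) ⟨0, hr⟩)).2
  obtain ⟨q, hq⟩ := (mem_of_nodeVal_le hr hopt hW hp hle).2
  refine le_antisymm (Finset.le_inf' _ _ fun q _ => nodeVal_le_of_mem hr hopt h q) ?_
  rw [hq]
  exact Finset.inf'_le _ (Finset.mem_univ q)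

end NodeValue

/-! ### Minimizers over binary polytopes -/

theorem dotProduct_realVec {m : ℕ} (c z : Fin m → ℚ) :
    realVec c ⬝ᵥ realVec z = ((∑ j, c j * z j : ℚ) : ℝ) := by
  simp [dotProduct, realVec]

/-- If a linear function attains its minimum over a compact set, then also at an extreme point. -/
theorem exists_extremePoint_isMinOn {m : ℕ} {Q : Set (Fin m → ℝ)} (hQ : IsCompact Q)
    (c z : Fin m → ℝ) (hz : z ∈ Q) (hmin : ∀ y ∈ Q, c ⬝ᵥ z ≤ c ⬝ᵥ y) :
    ∃ w ∈ Q.extremePoints ℝ, c ⬝ᵥ w = c ⬝ᵥ z := by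
  let l : (Fin m → ℝ) →L[ℝ] ℝ := LinearMap.toContinuousLinearMap
    (-(dotProductBilin ℝ ℝ c))
  have hl (y) : l y = -(c ⬝ᵥ y) := rfl
  have hexp : IsExposed ℝ Q (l.toExposed Q) := ContinuousLinearMap.toExposed.isExposed
  have hne : (l.toExposed Q).Nonempty := ⟨z, hz, fun y hy => by
    rw [hl, hl]; exact neg_le_neg (hmin y hy)⟩
  obtain ⟨w, hw⟩ := (hexp.isCompact hQ).extremePoints_nonempty hne
  refine ⟨w, hexp.isExtreme.extremePoints_subset_extremePoints hw, le_antisymm ?_ ?_⟩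
  · have := (extremePoints_subset hw).2 z hz
    rw [hl, hl] at this
    linarith
  · exact hmin w (extremePoints_subset hw).1

/-- A minimum over a polytope with binary vertices is also attained at a binary point, even where
the minimizer `z` that is given is not a vertex. -/
theorem exists_binary_isMinOn {m : ℕ} {Q : Set (Fin m → ℝ)} (hQ : IsCompact Q)
    (hbin : ∀ z ∈ Q.extremePoints ℝ, ∀ j, z j = 0 ∨ z j = 1) (c z : Fin m → ℚ)
    (hz : realVec z ∈ Q) (hmin : ∀ y ∈ Q, realVec c ⬝ᵥ realVec z ≤ realVec c ⬝ᵥ y) :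
    ∃ w : Fin m → ℚ, ((∀ j, w j = 0 ∨ w j = 1) ∧ realVec w ∈ Q) ∧
      ∑ j, c j * z j = ∑ j, c j * w j := by
  obtain ⟨y, hy, hyz⟩ := exists_extremePoint_isMinOn hQ _ _ hz hmin
  refine ⟨fun j => if y j = 0 then 0 else 1, ⟨fun j => by dsimp only; split <;> simp, ?_⟩, ?_⟩
  all_goals
    have h : realVec (fun j => if y j = 0 then (0 : ℚ) else 1) = y := by
      funext j
      rcases hbin y hy j with h | h <;> simp [realVec, h]
  · rw [h]
    exact extremePoints_subset hy
  · rw [← h, dotProduct_realVec, dotProduct_realVec] at hyz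
    exact_mod_cast hyz.symm

/-! ### The tuple found by the beam search -/

section Tuple

variable {m r k : ℕ} {Q : Set (Fin m → ℝ)} {opt : (Fin m → ℚ) → List ℚ} {c : Fin r → Fin m → ℚ}
  {d : Fin r → ℚ}

/-- The lists of signs of binary points of `Q` among the `k` leaves that the beam search keeps. -/
def beamTuple (opt : (Fin m → ℚ) → List ℚ) (k : ℕ) (c : Fin r → Fin m → ℚ) (d : Fin r → ℚ) :
    List (List ℚ) :=
  (beam k (nodeVal opt (2 * affineBound c d + 1) c d) m).filter fun p =>
    decide (nodeVal opt (2 * affineBound c d + 1) c d p ≤ affineBound c d)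

theorem SignLt.toLex_lt {p p' : List ℚ} (hp : IsSignList m p) (h : SignLt p p') :
    toLex (signBits m p) < toLex (signBits m p') := by
  obtain ⟨l, x, y, rfl, rfl⟩ := h
  have hl : l.length < m := by rw [← hp.1]; simp
  refine ⟨⟨l.length, hl⟩, fun j hj => ?_, ?_⟩
  · have hj' : (j : ℕ) < l.length := hj
    simp [signBits, List.getD_eq_getElem?_getD, List.getElem?_append, hj']
  · simp [signBits, List.getD_eq_getElem?_getD]

/-- If `k` of the leaves that the beam search keeps are in `Q`, then they form a tuple in `L_{k,Q}`,
and the sum of their values is the left-hand side of its inequality. -/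
theorem beamTuple_sound (hr : 0 < r)
    (hopt : IsMinimizer {w | (∀ j, w j = 0 ∨ w j = 1) ∧ realVec w ∈ Q} opt)
    (hne : (Finset.univ : Finset (Fin r)).Nonempty)
    (hlen : (beamTuple opt k c d).length = k) :
    ∃ z ∈ lexTuples k Q,
      (beamTuple opt k c d).map (fun p => List.ofFn (signBits m p)) =
        List.ofFn (fun i => List.ofFn (z i)) ∧
      ((beamTuple opt k c d).map (nodeVal opt (2 * affineBound c d + 1) c d)).sum =
        ∑ i, Finset.univ.inf' hne fun q => c q ⬝ᵥ z i + d q := by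
  set F := beamTuple opt k c d with hF
  have hW : ∀ w ∈ {w : Fin m → ℚ | (∀ j, w j = 0 ∨ w j = 1) ∧ realVec w ∈ Q},
    ∀ j, w j = 0 ∨ w j = 1 := fun w hw => hw.1
  have hsign {p} (hp : p ∈ F) : IsSignList m p := isSignList_of_mem_beam (List.mem_filter.1 hp).1
  have hmem {p} (hp : p ∈ F) := (mem_of_nodeVal_le hr hopt hW (hsign hp)
    (by simpa using (List.mem_filter.1 hp).2)).1
  have hpair : F.Pairwise SignLt := (pairwise_beam m).sublist List.filter_sublist
  clear_value F
  subst hlen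
  refine ⟨fun i => signBits m (F.get i), ⟨fun i j => ?_, fun i j hij => ?_, fun i => ?_⟩, ?_, ?_⟩
  · exact (hmem (F.get_mem i)).1 j
  · exact (List.pairwise_iff_get.1 hpair i j hij).toLex_lt (hsign (F.get_mem i))
  · exact (hmem (F.get_mem i)).2
  · conv_lhs => rw [← List.ofFn_get F, List.map_ofFn]
    rfl
  · conv_lhs => rw [← List.ofFn_get F, List.map_ofFn, List.sum_ofFn]
    exact Finset.sum_congr rfl fun i _ =>
      nodeVal_eq_inf' hr hopt hW (hsign (F.get_mem i)) (hmem (F.get_mem i)) hne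

/-- If `L_{k,Q}` is nonempty and `k ≥ 1`, then all leaves that the beam search keeps are in `Q`, and
their tuple minimizes the left-hand side of the inequalities. -/
theorem beamTuple_complete (hr : 0 < r)
    (hopt : IsMinimizer {w | (∀ j, w j = 0 ∨ w j = 1) ∧ realVec w ∈ Q} opt)
    (hne : (Finset.univ : Finset (Fin r)).Nonempty) (hk : 1 ≤ k) {z : Fin k → Fin m → ℚ}
    (hz : z ∈ lexTuples k Q) :
    (beamTuple opt k c d).length = k ∧
      ((beamTuple opt k c d).map (nodeVal opt (2 * affineBound c d + 1) c d)).sum ≤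
        ∑ i, Finset.univ.inf' hne fun q => c q ⬝ᵥ z i + d q := by
  have hW : ∀ w ∈ {w : Fin m → ℚ | (∀ j, w j = 0 ∨ w j = 1) ∧ realVec w ∈ Q},
    ∀ j, w j = 0 ∨ w j = 1 := fun w hw => hw.1
  let σ (w : Fin m → ℚ) : List ℚ := List.ofFn fun j => 1 - 2 * w j
  have hbits (w : Fin m → ℚ) : signBits m (σ w) = w := by
    funext j
    simp only [signBits, σ, List.getD_eq_getElem?_getD]
    simp
    ring
  have hσ {w : Fin m → ℚ} (hw : ∀ j, w j = 0 ∨ w j = 1) : IsSignList m (σ w) := by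
    refine ⟨by simp [σ], fun s hs => ?_⟩
    obtain ⟨j, rfl⟩ := (List.mem_ofFn ..).1 hs
    rcases hw j with h | h <;> simp only [h] <;> norm_num
  have hinj : Function.Injective fun i => σ (z i) := fun i j h => by
    have := congrArg (signBits m) h
    simp only [hbits] at this
    exact hz.2.1.injective (congrArg toLex this)
  have hM : 0 ≤ 2 * affineBound c d + 1 := by linarith [affineBound_nonneg c d]
  obtain ⟨h₁, h₂, h₃⟩ := beam_optimal (v := nodeVal opt (2 * affineBound c d + 1) c d) hk
    (fun p s hp hs => nodeVal_le_append hr hopt hW hM p s hp hs)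
    (fun p hp => exists_nodeVal_append_le hr hopt hW p hp)
    (Finset.univ.image fun i => σ (z i))
    (fun w hw => by
      obtain ⟨i, -, rfl⟩ := Finset.mem_image.1 hw
      exact hσ (hz.1 i))
    (by rw [Finset.card_image_of_injective _ hinj]; simp)
  have hmem (i : Fin k) : signBits m (σ (z i)) ∈
      {w : Fin m → ℚ | (∀ j, w j = 0 ∨ w j = 1) ∧ realVec w ∈ Q} := by
    rw [hbits]
    exact ⟨hz.1 i, hz.2.2 i⟩
  have hF : beamTuple opt k c d = beam k (nodeVal opt (2 * affineBound c d + 1) c d) m := by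
    refine List.filter_eq_self.2 fun b hb => ?_
    obtain ⟨w, hw, hbw⟩ := h₂ b hb
    obtain ⟨i, -, rfl⟩ := Finset.mem_image.1 hw
    refine decide_eq_true (hbw.trans ((nodeVal_le_of_mem hr hopt (hmem i) ⟨0, hr⟩).trans ?_))
    exact (abs_le.1 (abs_le_affineBound c d (hmem i).1 _)).2
  rw [hF]
  refine ⟨h₁, h₃.trans (le_of_eq ?_)⟩
  rw [Finset.sum_image hinj.injOn]
  refine Finset.sum_congr rfl fun i _ => ?_
  rw [nodeVal_eq_inf' hr hopt hW (hσ (hz.1 i)) (hmem i) hne, hbits]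

end Tuple

/-! ### Programs for the steps of the beam search -/

namespace PolyTime

universe u
variable {I : Type u} {α : Type*} [DataEnc α] {sz : I → ℕ} {e : I → Data} {N : I → ℕ}

/-- Reading the entry at a computed position, as the sum of the entries at positions equal to it. -/
theorem getFn {a : ∀ i, Fin (N i) → ℚ} {t : ∀ i, Fin (N i)}
    (ha : PolyTime sz e fun i => List.ofFn (a i))
    (hN : PolyTime sz e fun i => List.ofFn fun j : Fin (N i) => ((j : ℕ) : ℚ))
    (ht : PolyTime sz e fun i => ((t i : ℕ) : ℚ)) : PolyTime sz e fun i => a i (t i) :=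
  ((ha.zipFn hN).mapFn
    (b := fun i j => bif decide (((j : ℕ) : ℚ) = ((t i : ℕ) : ℚ)) then a i j else 0) fun hx =>
      (hx.snd.eq (ht.weaken hx)).cond hx.fst (hx.const 0)).sumFn.congr fun i => by
    simp [Bool.cond_eq_ite, Fin.val_inj]

theorem dotFn {a b : ∀ i, Fin (N i) → ℚ} (ha : PolyTime sz e fun i => List.ofFn (a i))
    (hb : PolyTime sz e fun i => List.ofFn (b i)) : PolyTime sz e fun i => a i ⬝ᵥ b i :=
  ((ha.zipFn hb).mapFn fun hx => hx.fst.mul hx.snd).sumFn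

/-- The product of a vector and a matrix that is given by its rows. The `j`-th entry is the product
of the vector with the list of the `j`-th entries of the rows. -/
theorem vecMulFn {m : I → ℕ} {x : ∀ i, Fin (N i) → ℚ} {A : ∀ i, Matrix (Fin (N i)) (Fin (m i)) ℚ}
    (hx : PolyTime sz e fun i => List.ofFn (x i))
    (hA : PolyTime sz e fun i => List.ofFn fun l => List.ofFn (A i l))
    (hm : PolyTime sz e fun i => List.ofFn fun j : Fin (m i) => ((j : ℕ) : ℚ)) :
    PolyTime sz e fun i => List.ofFn (Matrix.vecMul (x i) (A i)) :=
  hm.mapFn fun hj => (hx.weaken hj).dotFn ((hA.weaken hj).mapFn fun hrow =>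
    hrow.getFn ((hm.weaken hj).weaken hrow) (hj.weaken hrow))

/-- The summands of `indexRank`. -/
theorem precedes {f g s t : I → ℚ} (hf : PolyTime sz e f) (hs : PolyTime sz e s)
    (hg : PolyTime sz e g) (ht : PolyTime sz e t) :
    PolyTime sz e fun i => if f i < g i ∨ f i = g i ∧ s i < t i then (1 : ℚ) else 0 :=
  ((hf.lt hg).cond (hf.const 1) (((hf.eq hg).and (hs.lt ht)).cond (hf.const 1) (hf.const 0))).congr
    fun i => by
      simp only [Bool.cond_eq_ite, Bool.and_eq_true, decide_eq_true_eq]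
      grind

theorem kSmallest {C : I → List α} {v : I → α → ℚ} {k : I → ℕ} (hC : PolyTime sz e C)
    (hk : PolyTime sz e fun i => (k i : ℚ))
    (hv : PolyTime (fun x : Σ i, Fin (C i).length => sz x.1)
        (fun x => .pair (e x.1) (enc ((C x.1).get x.2))) (fun x => (C x.1).get x.2) →
      PolyTime (fun x : Σ i, Fin (C i).length => sz x.1)
        (fun x => .pair (e x.1) (enc ((C x.1).get x.2))) fun x => v x.1 ((C x.1).get x.2)) :
    PolyTime sz e fun i => (C i).kSmallest (k i) (v i) := by
  have hC' : PolyTime sz e fun i => List.ofFn (C i).get := hC.congr fun i => by simp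
  have hz := (hC'.mapFn (b := fun i t => v i ((C i).get t)) hv).zipFn
    (hC.length.range hC.bdd_length)
  have hf := (hC'.zipFn hz).filterFn
    (c := fun i t => decide (indexRank (fun u => v i ((C i).get u)) t < k i)) fun hx => by
      have hrank := ((hz.weaken hx).mapFn (b := fun x u =>
        if v x.1 ((C x.1).get u) < v x.1 ((C x.1).get x.2) ∨
          v x.1 ((C x.1).get u) = v x.1 ((C x.1).get x.2) ∧ ((u : ℕ) : ℚ) < ((x.2 : ℕ) : ℚ)
        then (1 : ℚ) else 0) fun hy =>
        hy.fst.precedes hy.snd (hx.weaken hy).snd.fst (hx.weaken hy).snd.snd).sumFn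
      refine (hrank.lt (hk.weaken hx)).congr fun x => ?_
      refine decide_eq_decide.2 ?_
      rw [← Nat.cast_lt (α := ℚ)]
      simp [indexRank]
  exact (hf.map (b := fun _ => Prod.fst) fun hx => hx.fst).congr fun i => by
    simp [List.kSmallest, Function.comp_def]

theorem signChildren {B : I → List (List ℚ)} (hB : PolyTime sz e B) :
    PolyTime sz e fun i => signChildren (B i) :=
  (hB.map (b := fun _ p => [p ++ [1], p ++ [-1]]) fun hx =>
    (hx.append ((hx.const 1).cons hx.nil)).cons
      ((hx.append ((hx.const (-1)).cons hx.nil)).cons hx.nil)).flatten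

theorem signBits {m : I → ℕ} {p : I → List ℚ}
    (hm : PolyTime sz e fun i => List.ofFn fun j : Fin (m i) => ((j : ℕ) : ℚ))
    (hp : PolyTime sz e p) : PolyTime sz e fun i => List.ofFn (signBits (m i) (p i)) :=
  (hm.padFn hp).mapFn fun hx => ((hx.const 1).sub hx.snd).mul (hx.const (1 / 2))

theorem affineBound {m r : I → ℕ} {c : ∀ i, Fin (r i) → Fin (m i) → ℚ} {d : ∀ i, Fin (r i) → ℚ}
    (h : PolyTime sz e fun i => List.ofFn fun q => (List.ofFn (c i q), d i q)) :
    PolyTime sz e fun i => affineBound (c i) (d i) :=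
  (h.mapFn fun hx => ((hx.fst.mapFn fun hy => (hy.mul hy).add (hy.const 1)).sumFn).add
    ((hx.snd.mul hx.snd).add (hx.const 1))).sumFn

theorem size_beam_le {k m : ℕ} {v : List ℚ → ℚ} {j : ℕ} (hj : j ≤ m) :
    (enc (beam k v j)).size ≤ 2 + (1 + k) * (1 + (2 + m * (1 + 3))) := by
  refine (DataEnc.size_list_le (B := 2 + m * (1 + 3)) fun p hp => ?_).trans ?_
  · obtain ⟨hlen, hs⟩ := isSignList_of_mem_beam hp
    refine (DataEnc.size_list_le (B := 3) fun s hs' => ?_).trans ?_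
    · rcases hs s hs' with rfl | rfl <;> simp [enc, Data.size]
    · rw [hlen]
      gcongr
  · have := length_beam_le (k := k) (v := v) j
    gcongr
    omega

end PolyTime

/-! ### The oracle -/

universe u

theorem DataEnc.enc_ofFn {α : Type*} [DataEnc α] {n : ℕ} (a : Fin n → α) :
    enc (List.ofFn a) = Data.ofList (List.ofFn fun i => enc (a i)) := by
  change Data.ofList ((List.ofFn a).map enc) = _
  rw [List.map_ofFn]
  rfl

theorem DataEnc.enc_ofVec {n : ℕ} (v : Fin n → ℚ) : enc (List.ofFn v) = Data.ofVec v :=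
  DataEnc.enc_ofFn v

theorem DataEnc.enc_ofMat {m n : ℕ} (M : Fin m → Fin n → ℚ) :
    enc (List.ofFn fun i => List.ofFn (M i)) = Data.ofMat M := by
  simp only [DataEnc.enc_ofFn]
  rfl


/-- The value of `opt` at a vector can be computed in polynomial time from the vector and the code
of the polytope, whenever these are themselves so computable and the dimension is polynomially
bounded. -/
def IsPolyTimeOracle {ι : Type u} (F : PolytopeFamily ι)
    (opt : ∀ i, (Fin (F.dim i) → ℚ) → List ℚ) : Prop :=
  ∀ (I : Type u) (sz : I → ℕ) (e : I → Data) (idx : I → ι) (c : ∀ x, Fin (F.dim (idx x)) → ℚ),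
    PolyBdd sz (fun x => F.dim (idx x)) → PolyTime sz e (fun x => F.code (idx x)) →
    PolyTime sz e (fun x => List.ofFn (c x)) → PolyTime sz e fun x => opt (idx x) (c x)

/-- The function computed by an optimization algorithm, as a function `opt` to lists of numbers
(whose value is the empty list where the polytope is empty). The algorithm also tells whether
the polytope is empty. As the algorithm has to read the code of the polytope within its time
bound, the length of this code is polynomial in the dimension. -/
theorem PolytopeFamily.IsTractableBinary.exists_optimizer {ι : Type u} {F : PolytopeFamily ι}
    (hF : F.IsTractableBinary) : ∃ opt : ∀ i, (Fin (F.dim i) → ℚ) → List ℚ,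
      (∀ i, F.Q i ≠ ∅ →
        IsMinimizer {w | (∀ j, w j = 0 ∨ w j = 1) ∧ realVec w ∈ F.Q i} (opt i)) ∧
      (PolyBdd F.dim fun i => (F.code i).size) ∧
      ∀ (I : Type u) (sz : I → ℕ) (e : I → Data) (idx : I → ι)
        (c : ∀ x, Fin (F.dim (idx x)) → ℚ), PolyBdd sz (fun x => F.dim (idx x)) →
        PolyTime sz e (fun x => F.code (idx x)) → PolyTime sz e (fun x => List.ofFn (c x)) →
        PolyTime sz e (fun x => opt (idx x) (c x)) ∧
        ∀ _ : ∀ x, Decidable (F.Q (idx x) = ∅),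
          PolyTime sz e fun x => decide (F.Q (idx x) = ∅) := by
  obtain ⟨P, p, hP⟩ := hF.optimization
  choose w t hrun hvalid htime using hP
  have hopt (i : ι) (c : Fin (F.dim i) → ℚ) : ∃ l : List ℚ, enc l = Op.snd.eval (w ⟨i, c⟩) ∧
      (F.Q i ≠ ∅ → ∃ z, l = List.ofFn z ∧ realVec z ∈ F.Q i ∧
        ∀ y ∈ F.Q i, realVec c ⬝ᵥ realVec z ≤ realVec c ⬝ᵥ y) := by
    rcases hvalid ⟨i, c⟩ with ⟨h, h'⟩ | ⟨z, h, hz⟩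
    · exact ⟨[], by rw [h']; rfl, fun hne => absurd h hne⟩
    · exact ⟨List.ofFn z, by rw [h, DataEnc.enc_ofVec]; rfl, fun _ => ⟨z, rfl, hz⟩⟩
  choose opt henc hmin using hopt
  refine ⟨opt, fun i hne c => ?_, ?_, fun I sz e idx c hdim hcode hc => ?_⟩
  · obtain ⟨z, hz, hzQ, hzmin⟩ := hmin i c hne
    have hget (j : Fin (F.dim i)) : (opt i c).getD j 0 = z j := by
      rw [hz]
      simp [List.getD_eq_getElem?_getD]
    simp only [hget]
    refine ⟨fun y hy => ?_, ?_⟩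
    · have := hzmin _ hy.2
      rw [dotProduct_realVec, dotProduct_realVec] at this
      exact_mod_cast this
    · obtain ⟨V, hV, hQ⟩ := hF.polytope i
      exact exists_binary_isMinOn (hQ ▸ hV.isCompact_convexHull ℝ) (hF.binary i) c z hzQ hzmin
  · refine PolyBdd.mono ((PolyBdd.self.add ((PolyBdd.const 2).add
      (PolyBdd.self.mul (.const 3)))).eval p) fun i => ?_
    have h₁ := (hrun ⟨i, 0⟩).size_le.1
    have h₂ := htime ⟨i, 0⟩
    have h₃ : (Data.ofVec (0 : Fin (F.dim i) → ℚ)).size = 2 + F.dim i * 3 := by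
      simp [Data.ofVec, Data.size_ofList, Data.size_zero]
    simp only [PolytopeFamily.optimization, Data.size, h₃] at h₁ h₂
    omega
  · have hw : PolyTime sz e fun x => w ⟨idx x, c x⟩ := by
      refine (hcode.pair hc).comp ⟨P, fun x => t ⟨idx x, c x⟩, fun x => ?_,
        ((hdim.add hc.bdd).eval p).mono fun x => ?_⟩
      · have := hrun ⟨idx x, c x⟩
        simp only [PolytopeFamily.optimization, ← DataEnc.enc_ofVec] at this
        exact this
      · have := htime ⟨idx x, c x⟩
        simpa only [PolytopeFamily.optimization, ← DataEnc.enc_ofVec] using this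
    refine ⟨(hw.op .snd PolyTime.size_op_snd).of_enc_eq fun x => (henc _ _).symm,
      fun inst => hw.isPair.not.congr fun x => ?_⟩
    rcases hvalid ⟨idx x, c x⟩ with ⟨h, h'⟩ | ⟨z, h, hz, -⟩
    · simp [h', h, Data.ofOption]
    · have : F.Q (idx x) ≠ ∅ := Set.nonempty_iff_ne_empty.1 ⟨_, hz⟩
      simp [h, this, Data.ofOption]

theorem PolyTime.nodeVal {ι : Type u} {F : PolytopeFamily ι}
    {opt : ∀ i, (Fin (F.dim i) → ℚ) → List ℚ}
    (hopt : IsPolyTimeOracle F opt)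
    {I : Type u} {sz : I → ℕ} {e : I → Data} {idx : I → ι} {r : I → ℕ}
    {c : ∀ x, Fin (r x) → Fin (F.dim (idx x)) → ℚ} {d : ∀ x, Fin (r x) → ℚ} {M : I → ℚ}
    {p : I → List ℚ} (hdim : PolyBdd sz fun x => F.dim (idx x))
    (hcode : PolyTime sz e fun x => F.code (idx x))
    (hcd : PolyTime sz e fun x => List.ofFn fun q => (List.ofFn (c x q), d x q))
    (hM : PolyTime sz e M) (hp : PolyTime sz e p) :
    PolyTime sz e fun x => nodeVal (opt (idx x)) (M x) (c x) (d x) (p x) :=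
  (hcd.mapFn fun hx =>
    have hcp := hx.fst.padFn (hp.weaken hx)
    have hz := hopt _ _ _ _ (fun x j => c x.1 x.2 j + M x.1 * (p x.1).getD j 0)
      (hdim.reindex Sigma.fst) (hcode.weaken hx)
      (hcp.mapFn fun hy => hy.fst.add (((hM.weaken hx).weaken hy).mul hy.snd))
    (((hcp.padFn hz).mapFn fun hy =>
      (hy.fst.fst.mul hy.snd).add (((hM.weaken hx).weaken hy).mul (hy.fst.snd.mul
        (hy.snd.sub (((hy.const 1).sub hy.fst.snd).mul (hy.const (1 / 2))))))).sumFn).add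
      hx.snd).minFn

theorem PolyTime.map_nodeVal {ι : Type u} {F : PolytopeFamily ι}
    {opt : ∀ i, (Fin (F.dim i) → ℚ) → List ℚ}
    (hopt : IsPolyTimeOracle F opt)
    {I : Type u} {sz : I → ℕ} {e : I → Data} {idx : I → ι} {r : I → ℕ}
    {c : ∀ x, Fin (r x) → Fin (F.dim (idx x)) → ℚ} {d : ∀ x, Fin (r x) → ℚ} {M : I → ℚ}
    {B : I → List (List ℚ)} (hdim : PolyBdd sz fun x => F.dim (idx x))
    (hcode : PolyTime sz e fun x => F.code (idx x))
    (hcd : PolyTime sz e fun x => List.ofFn fun q => (List.ofFn (c x q), d x q))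
    (hM : PolyTime sz e M) (hB : PolyTime sz e B) :
    PolyTime sz e fun x => (B x).map (_root_.nodeVal (opt (idx x)) (M x) (c x) (d x)) :=
  hB.map fun hx => .nodeVal hopt (hdim.reindex Sigma.fst) (hcode.weaken hx) (hcd.weaken hx)
    (hM.weaken hx) hx

theorem PolyTime.beamTuple {ι : Type u} {F : PolytopeFamily ι}
    {opt : ∀ i, (Fin (F.dim i) → ℚ) → List ℚ}
    (hopt : IsPolyTimeOracle F opt)
    {I : Type u} {sz : I → ℕ} {e : I → Data} {idx : I → ι} {r k : I → ℕ}
    {c : ∀ x, Fin (r x) → Fin (F.dim (idx x)) → ℚ} {d : ∀ x, Fin (r x) → ℚ}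
    (hdim : PolyBdd sz fun x => F.dim (idx x)) (hkb : PolyBdd sz k)
    (hcode : PolyTime sz e fun x => F.code (idx x))
    (hm : PolyTime sz e fun x => (F.dim (idx x) : ℚ)) (hk : PolyTime sz e fun x => (k x : ℚ))
    (hcd : PolyTime sz e fun x => List.ofFn fun q => (List.ofFn (c x q), d x q)) :
    PolyTime sz e fun x => beamTuple (opt (idx x)) (k x) (c x) (d x) := by
  have hT := hcd.affineBound
  have hM := ((hT.const 2).mul hT).add (hT.const 1)
  have hbeam := PolyTime.iterate (acc := fun x => beam (k x) (_root_.nodeVal (opt (idx x))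
      (2 * _root_.affineBound (c x) (d x) + 1) (c x) (d x))) hm hdim
    ((hm.nil.cons hm.nil).congr fun x => rfl)
    (((((PolyBdd.const 2).add (((PolyBdd.const 1).add hkb).mul ((PolyBdd.const 1).add
      ((PolyBdd.const 2).add (hdim.mul (.const (1 + 3)))))))).reindex Sigma.fst).mono fun x =>
        PolyTime.size_beam_le (Nat.lt_succ_iff.1 x.2.2))
    fun hB => hB.signChildren.kSmallest (hk.weaken hB) fun hC =>
      .nodeVal hopt ((hdim.reindex Sigma.fst).reindex Sigma.fst) ((hcode.weaken hB).weaken hC)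
        ((hcd.weaken hB).weaken hC) ((hM.weaken hB).weaken hC) hC
  exact hbeam.filter fun hx => (PolyTime.nodeVal hopt (hdim.reindex Sigma.fst) (hcode.weaken hx)
    (hcd.weaken hx) (hM.weaken hx) hx).le (hT.weaken hx)

/-! ### Separation of the joint-constraint inequalities -/

namespace JointInstance

variable {ι : Type u} {F : PolytopeFamily ι} (J : JointInstance F)

/-- The linear parts of the affine functions whose minimum is `φ(x, ·)`. -/
def linPart (q : Fin J.r) : Fin (F.dim J.idx) → ℚ := Matrix.vecMul J.x (J.A q)

/-- The constant parts of the affine functions whose minimum is `φ(x, ·)`. -/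
def constPart (q : Fin J.r) : ℚ := J.x ⬝ᵥ J.abar q - J.b q

theorem phi_eq (z : Fin (F.dim J.idx) → ℚ) :
    J.phi z = Finset.univ.inf' ⟨⟨0, J.r_pos⟩, Finset.mem_univ _⟩ fun q : Fin J.r =>
      J.linPart q ⬝ᵥ z + J.constPart q := by
  simp only [phi, linPart, constPart, Matrix.dotProduct_mulVec, add_sub_assoc]

/-- The input as the encoding of a nested tuple. The final `0` is the leaf that ends the list of the
numerical data. -/
theorem input_eq : F.jointSeparation.input J =
    enc (F.code J.idx, (F.dim J.idx : ℚ), (J.n : ℚ), (J.r : ℚ), (J.k : ℚ), List.ofFn J.x,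
      (List.ofFn fun q => List.ofFn fun i => List.ofFn (J.A q i)),
      (List.ofFn fun q => List.ofFn (J.abar q)), List.ofFn J.b, (0 : ℚ)) := by
  have h : enc (List.ofFn fun q => List.ofFn fun i => List.ofFn (J.A q i)) =
      Data.ofList (List.ofFn fun q => Data.ofMat (J.A q)) := by
    rw [DataEnc.enc_ofFn]
    exact congrArg (fun f => Data.ofList (List.ofFn f)) (funext fun q => DataEnc.enc_ofMat (J.A q))
  change Data.pair _ (Data.ofList _) = .pair _ (.pair _ (.pair _ (.pair _ (.pair _ (.pair
    (enc (List.ofFn J.x)) (.pair (enc (List.ofFn fun q => List.ofFn fun i => List.ofFn (J.A q i)))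
      (.pair (enc (List.ofFn fun q => List.ofFn (J.abar q)))
        (.pair (enc (List.ofFn J.b)) _))))))))
  rw [h, DataEnc.enc_ofVec, DataEnc.enc_ofVec, DataEnc.enc_ofMat]
  rfl

end JointInstance

open Classical in
/-- The output of the separation algorithm: the rows found by the beam search, provided that `Q` is
nonempty, that there are `k` of them, and that their inequality is violated. -/
noncomputable def separationOutput {ι : Type u} {F : PolytopeFamily ι}
    (opt : ∀ i, (Fin (F.dim i) → ℚ) → List ℚ) (J : JointInstance F) : Data :=
  bif (!decide (F.Q J.idx = ∅)) &&
    (decide (((beamTuple (opt J.idx) J.k J.linPart J.constPart).length : ℚ) = J.k) &&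
    decide (((beamTuple (opt J.idx) J.k J.linPart J.constPart).map (nodeVal (opt J.idx)
      (2 * affineBound J.linPart J.constPart + 1) J.linPart J.constPart)).sum < 0))
  then .ofOption (some (enc ((beamTuple (opt J.idx) J.k J.linPart J.constPart).map
    fun p => List.ofFn (signBits (F.dim J.idx) p))))
  else .ofOption none

theorem separationOutput_valid {ι : Type u} {F : PolytopeFamily ι}
    {opt : ∀ i, (Fin (F.dim i) → ℚ) → List ℚ}
    (hopt : ∀ i, F.Q i ≠ ∅ →
      IsMinimizer {w | (∀ j, w j = 0 ∨ w j = 1) ∧ realVec w ∈ F.Q i} (opt i))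
    (J : JointInstance F) : F.jointSeparation.Valid J (separationOutput opt J) := by
  have hphi (z : Fin J.k → Fin (F.dim J.idx) → ℚ) : ∑ i, J.phi (z i) = ∑ i, Finset.univ.inf'
      ⟨⟨0, J.r_pos⟩, Finset.mem_univ _⟩ fun q : Fin J.r => J.linPart q ⬝ᵥ z i + J.constPart q :=
    Finset.sum_congr rfl fun i _ => J.phi_eq (z i)
  unfold separationOutput
  rw [Bool.cond_eq_ite]
  split_ifs with h
  · simp only [Bool.and_eq_true, Bool.not_eq_true', decide_eq_false_iff_not, decide_eq_true_eq,
      Nat.cast_inj] at h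
    obtain ⟨hne, hlen, hsum⟩ := h
    obtain ⟨z, hz, hout, hz'⟩ := beamTuple_sound J.r_pos (hopt J.idx hne)
      ⟨⟨0, J.r_pos⟩, Finset.mem_univ _⟩ hlen
    refine .inr ⟨z, hz, by rw [hout, DataEnc.enc_ofMat], ?_⟩
    rw [JointInstance.Satisfied, hphi, ← hz']
    exact not_le.2 hsum
  · refine .inl ⟨fun z hz => ?_, rfl⟩
    by_contra hsat
    rw [JointInstance.Satisfied, not_le] at hsat
    -- The sum over an empty tuple is not negative.
    have hk : 0 < J.k := by
      by_contra hk
      have : IsEmpty (Fin J.k) := by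
        rw [Nat.eq_zero_of_not_pos hk]
        infer_instance
      simp at hsat
    have hne : F.Q J.idx ≠ ∅ := Set.nonempty_iff_ne_empty.1 ⟨_, hz.2.2 ⟨0, hk⟩⟩
    obtain ⟨hlen, hsum⟩ := beamTuple_complete (c := J.linPart) (d := J.constPart) J.r_pos
      (hopt J.idx hne) ⟨⟨0, J.r_pos⟩, Finset.mem_univ _⟩ hk hz
    rw [hphi] at hsat
    simp [hne, hlen, hsum.trans_lt hsat] at h

theorem mainTheorem3 {ι : Type*} (F : PolytopeFamily ι) (hF : F.IsTractableBinary) :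
    F.jointSeparation.PolyTimeSolvable := by
  classical
  obtain ⟨opt, hmin, hsize, hopt⟩ := hF.exists_optimizer
  suffices h : PolyTime F.jointSeparation.size F.jointSeparation.input (separationOutput opt) by
    obtain ⟨P, t, hr, p, hp⟩ := h
    exact ⟨P, p, fun J => ⟨_, t J, hr J, separationOutput_valid hmin J, hp J⟩⟩
  set sz := F.jointSeparation.size with hsz
  set e := F.jointSeparation.input with he
  have hsz' (J : JointInstance F) :
      sz J = F.dim J.idx + J.n + J.r + J.k + J.encodedData.size := rfl
  have hdim : PolyBdd sz fun J => F.dim J.idx := PolyBdd.self.mono fun J => by rw [hsz']; omega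
  have hkb : PolyBdd sz JointInstance.k := PolyBdd.self.mono fun J => by rw [hsz']; omega
  obtain ⟨p, hp⟩ := hsize
  have hin := (PolyTime.env (sz := sz) (e := e)
    ((((PolyBdd.const 1).add (hdim.eval p)).add .self).mono fun J => by
      have h₁ : (F.code J.idx).size ≤ p.eval (F.dim J.idx) := hp J.idx
      have h₂ := hsz' J
      have h₃ : (e J).size = 1 + (F.code J.idx).size + J.encodedData.size := rfl
      omega)).of_enc_eq fun J => J.input_eq
  have hcode := hin.fst
  have hm := hin.snd.fst
  have hk := hin.snd.snd.snd.snd.fst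
  have hx := hin.snd.snd.snd.snd.snd.fst
  have hA := hin.snd.snd.snd.snd.snd.snd.fst
  have habar := hin.snd.snd.snd.snd.snd.snd.snd.fst
  have hb := hin.snd.snd.snd.snd.snd.snd.snd.snd.fst
  have hrange := hm.range hdim
  have hcd : PolyTime sz e fun J => List.ofFn fun q => (List.ofFn (J.linPart q), J.constPart q) :=
    (hA.zipFn (habar.zipFn hb)).mapFn fun hq => ((hx.weaken hq).vecMulFn hq.fst
      (hrange.weaken hq)).pair (((hx.weaken hq).dotFn hq.snd.fst).sub hq.snd.snd)
  have hT := hcd.affineBound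
  have hM := ((hT.const 2).mul hT).add (hT.const 1)
  have hopt' : IsPolyTimeOracle F opt := fun I sz e idx c h₁ h₂ h₃ => (hopt I sz e idx c h₁ h₂ h₃).1
  have htuple : PolyTime sz e fun J => beamTuple (opt J.idx) J.k J.linPart J.constPart :=
    .beamTuple hopt' hdim hkb hcode hm hk hcd
  have hempty := (hopt _ sz e _ (fun _ _ => 0) hdim hcode (hrange.mapFn fun hx => hx.const 0)).2
    inferInstance
  have hsum := (PolyTime.map_nodeVal (idx := JointInstance.idx) hopt' hdim hcode hcd hM htuple).sum
  have hbits := htuple.map (b := fun J p => List.ofFn (signBits (F.dim J.idx) p)) fun hx =>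
    (hrange.weaken hx).signBits hx
  exact (hempty.not.and ((htuple.length.eq hk).and (hsum.lt (hsum.const 0)))).cond
    (((hbits.const 1).pair hbits).of_enc_eq fun J => rfl)
    ((hbits.const 0).of_enc_eq fun J => rfl)
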